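/- Let $1\le k\le d$ and let $X$ be a (not necessarily thick) building, with vertex set $X^0$ and set of $j$-simplices $X^j$, whose apartments are Coxeter complexes of type $\widetilde A_d$. Simplices are identified with their vertex sets. The Coxeter complex of type $\widetilde A_d$ has vertex set $\mathbb Z^{d+1}/\mathbb Z\cdot(1,\ldots,1)$; call a tuple $(x_0,\ldots,x_j)$ of its vertices a standard pointed simplex if there are subsets $\emptyset\ne J_0\subsetneq\cdots\subsetneq J_{j-1}\subsetneq\{0,\ldots,d\}$ such that $x_t-x_j$ is represented by $\sum_{i\in J_t}e_i$ for $0\le t\le j-1$; the simplices are the underlying sets of the standard pointed simplices. Fix an orientation of $X$, i.e. a distinguished class of tuples of vertices, called pointed simplices, each enumerating without repetition the vertices of a simplex of $X$, such that every apartment has an isomorphism onto the Coxeter complex of type $\widetilde A_d$ under which a tuple of vertices of the apartment is a pointed simplex if and only if its image is a standard pointed simplex. (The pointed enumerations of a simplex then form one cyclic ordering of its vertices.) For a pointed simplex $(x_0,\ldots,x_j)$ let $\ell((x_0,\ldots,x_j))$ be the maximal $r$ such that there is a pointed $r$-simplex $(y_0,\ldots,y_r)$ with $y_0=x_0$ and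 $y_r=x_j$. For a pointed $(k-1)$-simplex $\widehat\eta=(x_1,\ldots,x_k)$ put $$N_{\widehat\eta}=\{z\in X^0 \mid (z,x_1,\ldots,x_k)\text{ is a pointed }k\text{-simplex}\},$$ and for $u_1,u_2\in N_{\widehat\eta}$ write $u_1\le u_2$ if $u_1=u_2$ or $(u_1,u_2,x_1,\ldots,x_k)$ is a pointed $(k+1)$-simplex. If the set $W=\{u\in N_{\widehat\eta}\mid u\le u_1\text{ and }u\le u_2\}$ is non-empty, let $[\widehat\eta|u_1,u_2]$ be the element $u\in W$ with $\ell((u,\widehat\eta))<\ell((w,\widehat\eta))$ for all $w\in W\setminus\{u\}$; otherwise $[\widehat\eta|u_1,u_2]$ is undefined. A subset $M_0\subseteq N_{\widehat\eta}$ is called stable with respect to $\widehat\eta$ if for all $u_1,u_2\in M_0$ the vertex $[\widehat\eta|u_1,u_2]$ is defined and belongs to $M_0$. A homological coefficient system $\mathcal V$ on $X$ assigns to every simplex $\tau$ an abelian group $\mathcal V(\tau)$ and to every face inclusion $\sigma\subseteq\tau$ a homomorphism $r^\tau_\sigma:\mathcal V(\tau)\to\mathcal V(\sigma)$ such that $r^\tau_\tau=\mathrm{id}$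 and $r^{\sigma}_{\rho}\circ r^{\tau}_{\sigma}=r^{\tau}_{\rho}$ whenever $\rho\subseteq\sigma\subseteq\tau$. Fix a labelling of the vertices of $X$ by $\{0,\ldots,d\}$ for which the vertices of each simplex have distinct labels, and for a codimension one face $\tau\setminus\{v\}$ of a simplex $\tau$ let $[\tau:\tau\setminus\{v\}]=(-1)^i$, where $i$ is the number of vertices of $\tau$ whose label is smaller than that of $v$. Let $C_j(X,\mathcal V)=\bigoplus_{\tau\in X^j}\mathcal V(\tau)$, with differential $\partial_j:C_{j+1}(X,\mathcal V)\to C_j(X,\mathcal V)$, $$(\partial_j c)_\tau=\sum_{\tau'\in X^{j+1},\ \tau'\supset\tau}[\tau':\tau]\,r^{\tau'}_{\tau}(c_{\tau'}),$$ and let $H_j(X,\mathcal V)$ denote the homology groups of this complex. Let $\mathcal V$ be a homological coefficient system on $X$, and suppose that condition $\mathcal S^*(k)$ holds: for every pointed $(k-1)$-simplex $\widehat\eta$ with underlying simplex $\eta$ and every $M_0\subseteq N_{\widehat\eta}$ which is stable with respect to $\widehat\eta$, the subquotient complex $$\bigoplus_{\substack{\{z,z'\}\in X^1\\ z,z'\in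 M_0}}\mathcal V(\{z,z'\}\cup\eta)\xrightarrow{\ \partial_k\ }\bigoplus_{z\in M_0}\mathcal V(\{z\}\cup\eta)\xrightarrow{\ \partial_{k-1}\ }\mathcal V(\eta)$$ of $(C_\bullet(X,\mathcal V),\partial)$ is exact. Then $H_k(X,\mathcal V)=0$. -/

import Mathlib

namespace TildeA

universe u w

/-! ### The Coxeter complex of type `Ã_d` -/

/-- The vertex set `ℤ^{d+1} / ℤ·(1, …, 1)` of the Coxeter complex of type `Ã_d`, i.e. of the
tessellation of `ℝ^{d+1} / ℝ·(1, …, 1)` by the hyperplanes `x_i - x_j = m` (`i ≠ j`, `m ∈ ℤ`). -/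
abbrev CoxVertex (d : ℕ) : Type :=
  (Fin (d + 1) → ℤ) ⧸ AddSubgroup.zmultiples (1 : Fin (d + 1) → ℤ)

/-- The class of `∑_{j ∈ J} e_j`. -/
def stdVec {d : ℕ} (J : Finset (Fin (d + 1))) : CoxVertex d :=
  QuotientAddGroup.mk (∑ j ∈ J, Pi.single j 1)

/-- `(x_0, …, x_k)` is a standard pointed simplex: there are
`∅ ≠ J_0 ⊊ … ⊊ J_{k-1} ⊊ {0, …, d}` such that `∑_{j ∈ J_t} e_j` represents `x_t - x_k` for all
`0 ≤ t ≤ k - 1`. (Here `x_k` is called `b` and `Js` is the list of the `J_t`.) -/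
def StdPointed {d : ℕ} (l : List (CoxVertex d)) : Prop :=
  ∃ (b : CoxVertex d) (Js : List (Finset (Fin (d + 1)))),
    Js.Pairwise (· ⊂ ·) ∧ (∀ J ∈ Js, J.Nonempty ∧ J ≠ Finset.univ) ∧
      l = Js.map (fun J => b + stdVec J) ++ [b]

theorem stdVec_univ {d : ℕ} : stdVec (Finset.univ : Finset (Fin (d + 1))) = 0 := by
  unfold stdVec
  rw [QuotientAddGroup.eq_zero_iff]
  refine AddSubgroup.mem_zmultiples_iff.2 ⟨1, ?_⟩
  ext i
  simp [Finset.sum_apply, Pi.single_apply]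

theorem stdVec_union {d : ℕ} {I J : Finset (Fin (d + 1))} (h : Disjoint I J) :
    stdVec (I ∪ J) = stdVec I + stdVec J := by
  unfold stdVec
  rw [Finset.sum_union h]
  rfl

/-- A nonempty subtuple of a standard pointed simplex is a standard pointed simplex. -/
theorem StdPointed.sublist {d : ℕ} {l l' : List (CoxVertex d)} (h : StdPointed l)
    (hs : l'.Sublist l) (hne : l' ≠ []) : StdPointed l' := by
  obtain ⟨b, Js, hJ, hJs, rfl⟩ := h
  obtain ⟨l₁, l₂, rfl, h₁, h₂⟩ := List.sublist_append_iff.1 hs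
  obtain ⟨Ks, hKs, rfl⟩ := List.sublist_map_iff.1 h₁
  have hK := hJ.sublist hKs
  have hK' : ∀ J ∈ Ks, J.Nonempty ∧ J ≠ Finset.univ := fun J hJ' => hJs J (hKs.subset hJ')
  rcases List.sublist_singleton.1 h₂ with rfl | rfl
  · rcases List.eq_nil_or_concat Ks with rfl | ⟨Ls, K, rfl⟩
    · simp at hne
    · rw [List.concat_eq_append] at hK hK' ⊢
      rw [List.pairwise_append] at hK
      obtain ⟨hL, -, hLK⟩ := hK
      have hLK' : ∀ J ∈ Ls, J ⊂ K := fun J hJ' => hLK J hJ' K (by simp)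
      refine ⟨b + stdVec K, Ls.map (fun J => J ∪ Kᶜ), ?_, ?_, ?_⟩
      · rw [List.pairwise_map]
        refine hL.imp_of_mem ?_
        intro I J hI hJ' hIJ
        have hJK := hLK' J hJ'
        rw [Finset.ssubset_iff_of_subset (Finset.union_subset_union_left hIJ.1)]
        obtain ⟨x, hx, hxI⟩ := Finset.exists_of_ssubset hIJ
        refine ⟨x, Finset.mem_union_left _ hx, ?_⟩
        have := hJK.1 hx
        simp [hxI, this]
      · intro J' hJ'
        obtain ⟨J, hJ, rfl⟩ := List.mem_map.1 hJ'
        refine ⟨((hK' J (by simp [hJ])).1).mono Finset.subset_union_left, ?_⟩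
        obtain ⟨x, hx, hxJ⟩ := Finset.exists_of_ssubset (hLK' J hJ)
        intro hu
        have : x ∈ J ∪ Kᶜ := hu ▸ Finset.mem_univ x
        simp [hxJ, hx] at this
      · simp only [List.map_append, List.map_cons, List.map_nil, List.append_nil, List.map_map]
        congr 1
        refine List.map_congr_left ?_
        intro J hJ
        have hd : Disjoint J Kᶜ :=
          Finset.disjoint_left.2 fun x hx hx' => (Finset.mem_compl.1 hx') ((hLK' J hJ).1 hx)
        have hKK : stdVec K + stdVec Kᶜ = 0 := by
          rw [← stdVec_union disjoint_compl_right, Finset.union_compl, stdVec_univ]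
        simp only [Function.comp]
        rw [stdVec_union hd]
        calc b + stdVec J = b + stdVec J + (stdVec K + stdVec Kᶜ) := by rw [hKK, add_zero]
          _ = _ := by abel
  · exact ⟨b, Ks, hK, hK', rfl⟩

/-- The Coxeter complex of type `Ã_d`: its simplices are the underlying sets of the standard
pointed simplices. -/
def coxeterComplex (d : ℕ) : PreAbstractSimplicialComplex (CoxVertex d) where
  faces := {s | ∃ l, StdPointed l ∧ ∀ v, v ∈ s ↔ v ∈ l}
  isRelLowerSet_faces := by
    classical
    rintro s ⟨l, hl, hs⟩
    refine ⟨?_, ?_⟩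
    · obtain ⟨b, Js, -, -, rfl⟩ := hl
      exact ⟨b, (hs b).2 (by simp)⟩
    · rintro t hts ⟨v, hv⟩
      refine ⟨l.filter (· ∈ t), hl.sublist List.filter_sublist ?_, ?_⟩
      · exact List.ne_nil_of_mem (a := v) (by simp [hv, (hs v).1 (hts hv)])
      · intro x
        simp only [List.mem_filter, decide_eq_true_eq]
        exact ⟨fun hx => ⟨(hs x).1 (hts hx), hx⟩, fun hx => hx.2⟩

/-! ### Buildings of type `Ã_d` -/

/-- The vertices of a simplicial complex. -/
abbrev Vert {α : Type*} (K : PreAbstractSimplicialComplex α) : Type _ := {v : α // {v} ∈ K}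

/-- An isomorphism of simplicial complexes: a bijection between the vertices under which the
simplices correspond. -/
structure SimplicialIso {α β : Type*} (K : PreAbstractSimplicialComplex α)
    (L : PreAbstractSimplicialComplex β) where
  toEquiv : Vert K ≃ Vert L
  mem_iff : ∀ s : Finset (Vert K),
    s.map (Function.Embedding.subtype _) ∈ K ↔
      (s.map toEquiv.toEmbedding).map (Function.Embedding.subtype _) ∈ L

/-- A building (not necessarily thick) whose apartments are Coxeter complexes of type `Ã_d`, with
vertex set `V`. -/
structure Building (d : ℕ) (V : Type u) where
  complex : AbstractSimplicialComplex V
  nonempty : Nonempty V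
  /-- the system of apartments -/
  apartments : Set (PreAbstractSimplicialComplex V)
  /-- apartments are subcomplexes -/
  apartment_le : ∀ A ∈ apartments, A ≤ complex.toPreAbstractSimplicialComplex
  /-- apartments are Coxeter complexes of type `Ã_d` -/
  apartment_iso : ∀ A ∈ apartments, Nonempty (SimplicialIso A (coxeterComplex d))
  /-- any two simplices lie in a common apartment -/
  exists_apartment : ∀ s ∈ complex, ∀ t ∈ complex, ∃ A ∈ apartments, s ∈ A ∧ t ∈ A
  /-- if two apartments both contain the simplices `s` and `t`, there is an isomorphism between
  them which fixes `s` and `t` pointwise -/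
  exists_iso : ∀ A ∈ apartments, ∀ B ∈ apartments, ∀ s t : Finset V,
    s ∈ A → t ∈ A → s ∈ B → t ∈ B →
      ∃ φ : SimplicialIso A B, ∀ v : Vert A, v.1 ∈ s ∨ v.1 ∈ t → (φ.toEquiv v).1 = v.1

variable {d : ℕ} {V : Type u}

/-- An orientation of a building of type `Ã_d`, given by its pointed simplices, i.e. by the
enumerations `(x_0, …, x_k)` of the vertices of simplices which are compatible with the
distinguished cyclic orderings: on every apartment they correspond, under a suitable
identification with the Coxeter complex on `ℤ^{d+1} / ℤ·(1, …, 1)`, to the standard ones. -/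
structure Orientation (X : Building d V) where
  /-- `Pointed [x_0, …, x_k]`: the tuple `(x_0, …, x_k)` is a pointed `k`-simplex -/
  Pointed : List V → Prop
  simplex : ∀ l, Pointed l → ∃ s ∈ X.complex, ∀ v, v ∈ s ↔ v ∈ l
  apartment : ∀ A ∈ X.apartments, ∃ φ : SimplicialIso A (coxeterComplex d),
    ∀ l : List (Vert A),
      Pointed (l.map Subtype.val) ↔ StdPointed (l.map fun v => (φ.toEquiv v).1)

namespace Orientation

variable {X : Building d V} (o : Orientation X)

/-- For a pointed simplex `(x_0, …, x_k)`, the maximal `r` such that there is a pointed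
`r`-simplex `(y_0, …, y_r)` with `y_0 = x_0` and `y_r = x_k`. -/
noncomputable def len (l : List V) : ℕ :=
  sSup {r | ∃ l', o.Pointed l' ∧ l'.length = r + 1 ∧ l'.head? = l.head? ∧
    l'.getLast? = l.getLast?}

/-- The set `N_η̂` of all vertices `z` for which `(z, η̂)` is a pointed simplex. -/
def nbhd (η : List V) : Set V := {z | o.Pointed (z :: η)}

/-- The relation `u₁ ≤ u₂` on `N_η̂`. -/
def Le (η : List V) (u₁ u₂ : V) : Prop := u₁ = u₂ ∨ o.Pointed (u₁ :: u₂ :: η)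

/-- The set of all `u ∈ N_η̂` with `u ≤ u₁` and `u ≤ u₂`. -/
def lowerBounds (η : List V) (u₁ u₂ : V) : Set V :=
  {u | u ∈ o.nbhd η ∧ o.Le η u u₁ ∧ o.Le η u u₂}

/-- `[η̂ | u₁, u₂]` is defined and equal to `u`: the vertex `u` is the element of
`lowerBounds η u₁ u₂` for which `len (u, η̂)` is strictly minimal. -/
def IsMeet (η : List V) (u₁ u₂ u : V) : Prop :=
  u ∈ o.lowerBounds η u₁ u₂ ∧
    ∀ v ∈ o.lowerBounds η u₁ u₂, v ≠ u → o.len (u :: η) < o.len (v :: η)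

/-- `M₀ ⊆ N_η̂` is stable with respect to `η̂`: for all `u₁, u₂ ∈ M₀` the vertex `[η̂ | u₁, u₂]` is
defined and belongs to `M₀`. -/
def Stable (η : List V) (M₀ : Set V) : Prop :=
  M₀ ⊆ o.nbhd η ∧ ∀ u₁ ∈ M₀, ∀ u₂ ∈ M₀, ∃ u ∈ M₀, o.IsMeet η u₁ u₂ u

end Orientation

/-- A labelling of a building of type `Ã_d`: the vertices are labelled by `0, …, d` in such a way
that the vertices of every simplex have distinct labels (hence the vertices of every chamber are
in bijection with the labels). -/
structure Labelling (X : Building d V) where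
  label : V → Fin (d + 1)
  injOn : ∀ s ∈ X.complex, Set.InjOn label (s : Set V)

/-- The incidence number `[σ : σ - {v}]` with respect to the labelling: `(-1)^i` if `v` is the
`i`-th vertex (`i = 0, 1, …`) of `σ` in the order of the labels. -/
def Labelling.incidence {X : Building d V} (lab : Labelling X) (σ : Finset V) (v : V) : ℤ :=
  (-1) ^ (σ.filter fun x => lab.label x < lab.label v).card

/-! ### Homological coefficient systems and their chain complexes -/

/-- A homological coefficient system of abelian groups on (the simplicial complex of) `X`. -/
structure HomCoeffSystem (X : Building d V) where
  obj : {σ : Finset V // σ ∈ X.complex} → Type w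
  [addCommGroup : ∀ σ, AddCommGroup (obj σ)]
  /-- the homomorphism `𝒱(τ) → 𝒱(σ)` for a face `σ ⊆ τ` -/
  map : ∀ {σ τ : {σ : Finset V // σ ∈ X.complex}}, σ.1 ⊆ τ.1 → (obj τ →+ obj σ)
  map_self : ∀ (σ : {σ : Finset V // σ ∈ X.complex}) (h : σ.1 ⊆ σ.1) (x : obj σ), map h x = x
  map_map : ∀ {ρ σ τ : {σ : Finset V // σ ∈ X.complex}} (h₁ : ρ.1 ⊆ σ.1) (h₂ : σ.1 ⊆ τ.1)
    (h₃ : ρ.1 ⊆ τ.1) (x : obj τ), map h₁ (map h₂ x) = map h₃ x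

attribute [instance] HomCoeffSystem.addCommGroup

/-- The sets of `k + 1` vertices. The simplices of `X` which belong to it are the `k`-simplices,
and `Chains (dimSet V k)` below is the group `C_k(X, 𝒱)`. -/
def dimSet (V : Type u) (k : ℕ) : Set (Finset V) := {σ | σ.card = k + 1}

namespace HomCoeffSystem

variable {X : Building d V} (𝒱 : HomCoeffSystem.{u, w} X) (lab : Labelling X)

/-- The group `⨁_σ 𝒱(σ)` of chains supported on the simplices `σ` of `X` which belong to `S`. -/
abbrev Chains (S : Set (Finset V)) : Type _ :=
  DirectSum {σ : {σ : Finset V // σ ∈ X.complex} // σ.1 ∈ S} fun σ => 𝒱.obj σ.1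

open Classical in
/-- The boundary map `∂` from chains supported on `S` to chains supported on `T`,
`(∂c)_τ = ∑_{σ ⊃ τ} [σ : τ] r(c_σ)` for `τ ∈ T`; equivalently, for `x ∈ 𝒱(σ)` it is the sum, over
the codimension one faces `σ - {v}` of `σ` which belong to `T`, of `[σ : σ - {v}] r(x)`.
For `S = X^{k+1}`, `T = X^k` this is the differential `∂_k` of the chain complex; for subsets of
these it is the differential of the corresponding subquotient. -/
noncomputable def boundary (S T : Set (Finset V)) : 𝒱.Chains S →+ 𝒱.Chains T :=
  DirectSum.toAddMonoid fun σ =>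
    ∑ v ∈ σ.1.1,
      if h : σ.1.1.erase v ∈ X.complex ∧ σ.1.1.erase v ∈ T then
        lab.incidence σ.1.1 v •
          (DirectSum.of (fun τ : {τ : {τ : Finset V // τ ∈ X.complex} // τ.1 ∈ T} => 𝒱.obj τ.1)
            ⟨⟨σ.1.1.erase v, h.1⟩, h.2⟩).comp (𝒱.map (σ.1.1.erase_subset v))
      else 0

/-- The cycles in `C_k(X, 𝒱)`. -/
noncomputable def cycles : (k : ℕ) → AddSubgroup (𝒱.Chains (dimSet V k))
  | 0 => ⊤
  | k + 1 => (𝒱.boundary lab (dimSet V (k + 1)) (dimSet V k)).ker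

/-- The boundaries in `C_k(X, 𝒱)`. -/
noncomputable def boundaries (k : ℕ) : AddSubgroup (𝒱.Chains (dimSet V k)) :=
  (𝒱.boundary lab (dimSet V (k + 1)) (dimSet V k)).range

/-- The homology group `H_k(X, 𝒱)`. -/
abbrev Homology (k : ℕ) : Type _ :=
  𝒱.cycles lab k ⧸ (𝒱.boundaries lab k).addSubgroupOf (𝒱.cycles lab k)

open Classical in
/-- The simplices `{z} ∪ η` with `z ∈ M₀`. -/
def coneSet (η : List V) (M₀ : Set V) : Set (Finset V) :=
  {σ | ∃ z ∈ M₀, σ = {z} ∪ η.toFinset}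

open Classical in
/-- The simplices `{z, z'} ∪ η` with `z, z' ∈ M₀` and `{z, z'} ∈ X^1`. -/
def edgeConeSet (X : Building d V) (η : List V) (M₀ : Set V) : Set (Finset V) :=
  {σ | ∃ z ∈ M₀, ∃ z' ∈ M₀, z ≠ z' ∧ {z, z'} ∈ X.complex ∧ σ = {z, z'} ∪ η.toFinset}

open Classical in
/-- The condition `𝒮*(k)`: for every pointed `(k-1)`-simplex `η̂` and every `M₀ ⊆ N_η̂` which is
stable with respect to `η̂`, the sequence
`⨁_{z, z' ∈ M₀, {z, z'} ∈ X^1} 𝒱({z, z'} ∪ η) → ⨁_{z ∈ M₀} 𝒱({z} ∪ η) → 𝒱(η)` is exact. -/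
def SStar (o : Orientation X) (k : ℕ) : Prop :=
  ∀ η : List V, o.Pointed η → η.length = k → ∀ M₀ : Set V, o.Stable η M₀ →
    Function.Exact
      (𝒱.boundary lab (edgeConeSet X η M₀) (coneSet η M₀))
      (𝒱.boundary lab (coneSet η M₀) {η.toFinset})

end HomCoeffSystem

end TildeA

/-! Cycles are pushed towards a base vertex `z`. Let `h` be the distance from `z`, defined as the
height of the image under a retraction onto an apartment centred at a chamber containing `z`.
Measure a simplex by the sum of `h` over its vertices, and let η be a (k-1)-face of maximal sum `n`
among the faces of simplices carrying a `k`-cycle `c`. If η ∪ {v} carries `c`, comparison with its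
other faces shows that `v` is its lowest vertex. Hence, with η̂ the enumeration of η by increasing
height, `v` lies in the set `M` of those members of N_η̂ that are lower than every vertex of η. As
∂c = 0, the part of `c` on the simplices {v} ∪ η with v ∈ M is a cycle of the subquotient for `M`;
exactness makes it the image of a chain `b` on simplices {x, y} ∪ η. In c - ∂b the face η is gone. A
new simplex ({x, y} ∪ η) \ {u} has u ∈ η, and its faces have sum below `n`, since `x` and `y` are
lower than all of η. Only finitely many faces have sum `n`, so `n` can be lowered until nothing is
left (`exists_clear`, `exists_totalBoundary_eq`).

Exactness may be applied because `M` is stable (`IsHeight.stable`). In an apartment a pointed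
simplex is a chain of integer vectors between some `f` and `f + 1` (`stdPointed_iff`); the relation
≤ on N_η̂ becomes the coordinatewise order, and meets become coordinatewise minima
(`exists_isMeet`). A common lower bound exists in `M` because one of the neighbours of a vertex
nearer to `z`, the projection of `z`, precedes all the others (`IsHeight.exists_projection`). The
meet lies between this projection and η, hence is again lower than η.

The retractions rest on `rigid`: an injective, adjacency-preserving self-map of the Coxeter complex
that fixes a chamber pointwise is the identity. -/

namespace TildeA

variable {d : ℕ}

/-! ### Lifts of pointed simplices to periodic chains of integer vectors -/

/-- The class in `ℤ^{d+1} / ℤ·(1, …, 1)` of a vector. -/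
def cls (f : Fin (d + 1) → ℤ) : CoxVertex d := QuotientAddGroup.mk f

theorem cls_surjective : Function.Surjective (cls (d := d)) := QuotientAddGroup.mk_surjective

theorem cls_eq_iff {f g : Fin (d + 1) → ℤ} : cls f = cls g ↔ ∃ c : ℤ, ∀ i, g i = f i + c := by
  unfold cls
  rw [QuotientAddGroup.eq, AddSubgroup.mem_zmultiples_iff]
  refine exists_congr fun c => ?_
  rw [funext_iff]
  refine forall_congr' fun i => ?_
  simp
  constructor <;> intro h <;> omega

theorem cls_add_one (f : Fin (d + 1) → ℤ) : cls (f + 1) = cls f :=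
  (cls_eq_iff.2 ⟨1, fun _ => rfl⟩).symm

/-- The indicator vector of a set of coordinates. -/
def ind (J : Finset (Fin (d + 1))) : Fin (d + 1) → ℤ := fun i => if i ∈ J then 1 else 0

theorem stdVec_eq_cls (J : Finset (Fin (d + 1))) : stdVec J = cls (ind J) := by
  unfold stdVec cls ind
  congr 1
  ext i
  simp [Finset.sum_apply, Pi.single_apply]

/-- `f < g < f + 1`, where the order is that of functions: the vectors `f`, `g` are consecutive
lattices in a periodic chain. -/
def Window (f g : Fin (d + 1) → ℤ) : Prop := f < g ∧ g < f + 1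

theorem window_iff {f g : Fin (d + 1) → ℤ} : Window f g ↔
    (∀ i, f i ≤ g i) ∧ (∃ i, f i < g i) ∧ (∀ i, g i ≤ f i + 1) ∧ ∃ i, g i < f i + 1 := by
  simp only [Window, Pi.lt_def, Pi.le_def, Pi.add_apply, Pi.one_apply, and_assoc]

theorem Window.add {f g : Fin (d + 1) → ℤ} (h : Window f g) (c : Fin (d + 1) → ℤ) :
    Window (f + c) (g + c) := by
  refine ⟨by simpa using h.1, ?_⟩
  have := h.2
  rw [add_right_comm]
  simpa using this

/-- This is the source of the cyclic symmetry: `f + 1` has the class of `f`, so the first vertex may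
be moved to the end. -/
theorem Window.rotate {f g : Fin (d + 1) → ℤ} (h : Window f g) : Window g (f + 1) :=
  ⟨h.2, by simpa using h.1⟩

theorem Window.unrotate {f g : Fin (d + 1) → ℤ} (h : Window f g) : Window (g - 1) f := by
  refine ⟨?_, by simpa using h.1⟩
  rw [sub_lt_iff_lt_add]
  exact h.2

/-- Where `g` exceeds `f` it is already maximal, and where it equals `f` it is already minimal, so
no nonzero constant shift of `g` stays in the window. This makes lifts unique once one vector is
chosen. -/
theorem Window.eq_right {f g g' : Fin (d + 1) → ℤ} (h : Window f g) (h' : Window f g')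
    (hc : cls g = cls g') : g = g' := by
  obtain ⟨c, hc⟩ := cls_eq_iff.1 hc
  obtain ⟨h1, ⟨i, h2⟩, h3, j, h4⟩ := window_iff.1 h
  obtain ⟨h1', ⟨i', h2'⟩, h3', j', h4'⟩ := window_iff.1 h'
  have := hc i; have := hc j; have := h3' i; have := h1' j
  have : c = 0 := by omega
  ext k
  rw [hc k, this, add_zero]

theorem Window.eq_left {f g g' : Fin (d + 1) → ℤ} (h : Window g f) (h' : Window g' f)
    (hc : cls g = cls g') : g = g' := by
  have := h.rotate.eq_right h'.rotate (by rw [cls_add_one, cls_add_one, hc])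
  simpa using this

theorem Window.cls_ne {f g : Fin (d + 1) → ℤ} (h : Window f g) : cls f ≠ cls g := by
  intro hc
  obtain ⟨c, hc⟩ := cls_eq_iff.1 hc
  obtain ⟨h1, ⟨i, h2⟩, h3, j, h4⟩ := window_iff.1 h
  have := hc i; have := hc j
  omega

theorem ind_le_one (J : Finset (Fin (d + 1))) : ind J ≤ 1 := by
  intro i
  unfold ind
  split <;> simp

theorem ind_lt_one {J : Finset (Fin (d + 1))} (h : J ≠ Finset.univ) : ind J < 1 := by
  refine lt_of_le_of_ne (ind_le_one J) fun he => h ?_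
  ext i
  have := congrFun he i
  by_contra hi
  simp_all [ind]

theorem ind_lt_ind {I J : Finset (Fin (d + 1))} : ind I < ind J ↔ I ⊂ J := by
  have key : ∀ I J : Finset (Fin (d + 1)), ind I ≤ ind J ↔ I ⊆ J := by
    intro I J
    rw [Pi.le_def]
    refine forall_congr' fun i => ?_
    unfold ind
    by_cases h1 : i ∈ I <;> by_cases h2 : i ∈ J <;> simp [h1, h2]
  rw [lt_iff_le_not_ge, key, key]
  rfl

theorem ind_pos {J : Finset (Fin (d + 1))} (h : J.Nonempty) : 0 < ind J := by
  have : ind (∅ : Finset (Fin (d + 1))) = 0 := by ext; simp [ind]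
  rw [← this, ind_lt_ind]
  exact Finset.empty_ssubset.2 h

/-- Vectors in the window above `f` are obtained by adding `1` on a proper nonempty set of
coordinates. -/
theorem Window.exists_ind {f g : Fin (d + 1) → ℤ} (h : Window f g) :
    ∃ J : Finset (Fin (d + 1)), J.Nonempty ∧ J ≠ Finset.univ ∧ g = f + ind J := by
  obtain ⟨h1, ⟨i, h2⟩, h3, j, h4⟩ := window_iff.1 h
  refine ⟨Finset.univ.filter fun i => f i < g i, ⟨i, by simpa using h2⟩, ?_, ?_⟩
  · intro he
    have hj := Finset.mem_univ j
    rw [← he, Finset.mem_filter] at hj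
    omega
  · ext k
    have := h1 k; have := h3 k
    simp only [Pi.add_apply, ind, Finset.mem_filter, Finset.mem_univ, true_and]
    split <;> omega

theorem window_add_ind {f : Fin (d + 1) → ℤ} {J : Finset (Fin (d + 1))} (h : J.Nonempty)
    (h' : J ≠ Finset.univ) : Window f (f + ind J) :=
  ⟨by simpa using ind_pos h, by simpa using ind_lt_one h'⟩

/-- The last vertex `b`, represented by `β`, is lifted to `β + 1` and the others to `β + ind J`, so
that inclusions of the sets become inequalities of vectors. Conversely, all members of a chain
ending in `g` except the last lie in the window above `g - 1`, whose elements are `g - 1 + ind J`.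
-/
theorem stdPointed_iff {l : List (CoxVertex d)} : StdPointed l ↔
    l ≠ [] ∧ ∃ F : List (Fin (d + 1) → ℤ), F.Pairwise Window ∧ F.map cls = l := by
  constructor
  · rintro ⟨b, Js, hJ, hJs, rfl⟩
    obtain ⟨β, rfl⟩ := cls_surjective b
    refine ⟨by simp, Js.map (fun J => β + ind J) ++ [β + 1], ?_, ?_⟩
    · rw [List.pairwise_append, List.pairwise_map]
      refine ⟨?_, by simp, ?_⟩
      · refine hJ.imp_of_mem fun {I J} hI hJ hIJ => ⟨by simpa [ind_lt_ind] using hIJ, ?_⟩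
        rw [add_assoc]
        refine (add_lt_add_iff_left _).2 ((ind_lt_one (hJs J hJ).2).trans ?_)
        simpa using ind_pos (hJs I hI).1
      · intro f hf g hg
        obtain ⟨J, hJ, rfl⟩ := List.mem_map.1 hf
        obtain rfl := List.mem_singleton.1 hg
        refine ⟨by simpa using ind_lt_one (hJs J hJ).2, ?_⟩
        rw [add_assoc]
        refine (add_lt_add_iff_left _).2 ?_
        simpa using ind_pos (hJs J hJ).1
    · simp only [List.map_append, List.map_map, List.map_cons, List.map_nil, cls_add_one]
      congr 1
      refine List.map_congr_left fun J _ => ?_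
      rw [stdVec_eq_cls]
      rfl
  · rintro ⟨hne, F, hF, rfl⟩
    rcases List.eq_nil_or_concat F with rfl | ⟨G, g, rfl⟩
    · simp at hne
    rw [List.concat_eq_append, List.pairwise_append] at hF
    obtain ⟨hG, -, hg⟩ := hF
    have hg' : ∀ f ∈ G, Window (g - 1) f := fun f hf => (hg f hf g (by simp)).unrotate
    choose! J h1 h2 h3 using fun f (hf : f ∈ G) => (hg' f hf).exists_ind
    refine ⟨cls g, G.map J, ?_, ?_, ?_⟩
    · rw [List.pairwise_map]
      refine hG.imp_of_mem fun {f f'} hf hf' hff => ?_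
      have := hff.1
      rw [h3 f hf, h3 f' hf'] at this
      simpa [ind_lt_ind] using this
    · intro K hK
      obtain ⟨f, hf, rfl⟩ := List.mem_map.1 hK
      exact ⟨h1 f hf, h2 f hf⟩
    · simp only [List.concat_eq_append, List.map_append, List.map_map, List.map_cons,
        List.map_nil]
      congr 1
      refine List.map_congr_left fun f hf => ?_
      have := cls_add_one (g - 1)
      rw [sub_add_cancel] at this
      conv_lhs => rw [h3 f hf]
      rw [Function.comp, stdVec_eq_cls, this]
      rfl

theorem stdPointed_map_cls {F : List (Fin (d + 1) → ℤ)} (hF : F.Pairwise Window) (hne : F ≠ []) :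
    StdPointed (F.map cls) :=
  stdPointed_iff.2 ⟨by simpa using hne, F, hF, rfl⟩

theorem StdPointed.nodup {l : List (CoxVertex d)} (h : StdPointed l) : l.Nodup := by
  obtain ⟨-, F, hF, rfl⟩ := stdPointed_iff.1 h
  rw [List.Nodup, List.pairwise_map]
  exact hF.imp fun h => h.cls_ne

theorem StdPointed.ne_nil {l : List (CoxVertex d)} (h : StdPointed l) : l ≠ [] :=
  (stdPointed_iff.1 h).1

theorem pairwise_window_add {F : List (Fin (d + 1) → ℤ)} (hF : F.Pairwise Window)
    (c : Fin (d + 1) → ℤ) : (F.map (· + c)).Pairwise Window := by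
  rw [List.pairwise_map]
  exact hF.imp fun h => h.add c

theorem StdPointed.rotate_one {a : CoxVertex d} {l : List (CoxVertex d)} (h : StdPointed (a :: l)) :
    StdPointed (l ++ [a]) := by
  obtain ⟨-, F, hF, hl⟩ := stdPointed_iff.1 h
  obtain ⟨f, G, rfl, rfl, rfl⟩ := List.map_eq_cons_iff.1 hl
  rw [List.pairwise_cons] at hF
  refine stdPointed_iff.2 ⟨by simp, G ++ [f + 1], ?_, by simp [cls_add_one]⟩
  rw [List.pairwise_append]
  refine ⟨hF.2, by simp, fun g hg k hk => ?_⟩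
  obtain rfl := List.mem_singleton.1 hk
  exact (hF.1 g hg).rotate

theorem exists_const_of_cls_eq {f g : Fin (d + 1) → ℤ} (h : cls f = cls g) :
    ∃ c : Fin (d + 1) → ℤ, f + c = g ∧ ∀ k, cls (k + c) = cls k := by
  obtain ⟨c, hc⟩ := cls_eq_iff.1 h
  exact ⟨fun _ => c, by ext i; simp [hc], fun k => (cls_eq_iff.2 ⟨c, fun i => rfl⟩).symm⟩

/-- A lift of the tail of a standard pointed simplex extends to a lift of the whole simplex. -/
theorem StdPointed.exists_lift_append {l : List (CoxVertex d)} {H : List (Fin (d + 1) → ℤ)}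
    (hH : H.Pairwise Window) (hne : H ≠ []) (h : StdPointed (l ++ H.map cls)) :
    ∃ G : List (Fin (d + 1) → ℤ), (G ++ H).Pairwise Window ∧ G.map cls = l := by
  obtain ⟨-, F, hF, hl⟩ := stdPointed_iff.1 h
  obtain ⟨F₁, F₂, rfl, rfl, h₂⟩ := List.map_eq_append_iff.1 hl
  obtain ⟨x, H, rfl⟩ := List.exists_cons_of_ne_nil hne
  obtain ⟨y, K, rfl, hy, hK⟩ := List.map_eq_cons_iff.1 h₂
  obtain ⟨c, rfl, hc⟩ := exists_const_of_cls_eq hy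
  have hF' := pairwise_window_add hF c
  -- Both lists lie in the window above the same first vector and have the same classes, so they
  -- agree entry by entry.
  have : K.map (· + c) = H := by
    simp only [List.map_append, List.map_cons] at hF'
    have h1 := (List.pairwise_cons.1 (List.pairwise_append.1 hF').2.1).1
    have h2 := (List.pairwise_cons.1 hH).1
    have h3 : (K.map (· + c)).map cls = H.map cls := by
      rw [← hK, List.map_map]
      exact List.map_congr_left fun k _ => hc k
    generalize K.map (· + c) = K' at h1 h3
    clear hF' h₂ hK hF hH h hl hne
    induction K' generalizing H with
    | nil => simpa using h3
    | cons k K' ih =>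
      obtain ⟨k', H', rfl, h4, h5⟩ := List.map_eq_cons_iff.1 h3.symm
      rw [(h1 k (by simp)).eq_right (h2 k' (by simp)) h4.symm,
        ih H' (fun a ha => h2 a (by simp [ha])) (fun a ha => h1 a (by simp [ha])) h5.symm]
  subst this
  refine ⟨F₁.map (· + c), by simpa using hF', ?_⟩
  rw [List.map_map]
  exact List.map_congr_left fun k _ => hc k

theorem pairwise_window_of_subset {F : List (Fin (d + 1) → ℤ)} (hF : F.Pairwise Window)
    {f g : Fin (d + 1) → ℤ} (hf : f ∈ F) (hg : g ∈ F) : f = g ∨ Window f g ∨ Window g f := by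
  induction F with
  | nil => simp at hf
  | cons a F ih =>
    rw [List.pairwise_cons] at hF
    rcases List.mem_cons.1 hf with hf' | hf' <;> rcases List.mem_cons.1 hg with hg' | hg'
    · exact .inl (hf'.trans hg'.symm)
    · exact .inr (.inl (hf' ▸ hF.1 g hg'))
    · exact .inr (.inr (hg' ▸ hF.1 f hf'))
    · exact ih hF.2 hf' hg'

/-- The relation of the lattices between `y - 1` and `y` for the last vertex `y` of `H`. -/
theorem le_iff_stdPointed {H : List (Fin (d + 1) → ℤ)} (hne : H ≠ []) {g g' : Fin (d + 1) → ℤ}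
    (hg : (g :: H).Pairwise Window) (hg' : (g' :: H).Pairwise Window) :
    g ≤ g' ↔ cls g = cls g' ∨ StdPointed (cls g :: cls g' :: H.map cls) := by
  obtain ⟨x, H, rfl⟩ := List.exists_cons_of_ne_nil hne
  have h1 := (List.pairwise_cons.1 hg).1
  have h1' := (List.pairwise_cons.1 hg').1
  have hx := h1 x (by simp)
  have hx' := h1' x (by simp)
  constructor
  · intro h
    rcases h.eq_or_lt with rfl | h
    · exact .inl rfl
    · right
      refine stdPointed_map_cls (F := g :: g' :: x :: H) ?_ (by simp)
      refine List.pairwise_cons.2 ⟨?_, hg'⟩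
      intro f hf
      rcases List.mem_cons.1 hf with rfl | hf
      · exact ⟨h, hx'.1.trans hx.2⟩
      · exact h1 f hf
  · rintro (h | h)
    · exact (hx.eq_left hx' h).le
    · obtain ⟨G, hG, hl⟩ := StdPointed.exists_lift_append (l := [cls g, cls g'])
        (List.pairwise_cons.1 hg).2 hne h
      obtain ⟨k, G, rfl, hk, hl⟩ := List.map_eq_cons_iff.1 hl
      obtain ⟨k', G, rfl, hk', hl⟩ := List.map_eq_cons_iff.1 hl
      obtain rfl := List.map_eq_nil_iff.1 hl
      simp only [List.cons_append, List.nil_append, List.pairwise_cons] at hG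
      have e1 := (hG.1 x (by simp)).eq_left hx hk
      have e2 := (hG.2.1 x (by simp)).eq_left hx' hk'
      subst e1 e2
      exact (hG.1 k' (by simp)).1.le

theorem StdPointed.exists_window_left {f : Fin (d + 1) → ℤ} {a : CoxVertex d}
    (h : StdPointed [a, cls f]) : ∃ g, Window g f ∧ cls g = a := by
  obtain ⟨G, hG, hl⟩ := StdPointed.exists_lift_append (l := [a]) (H := [f]) (by simp) (by simp) h
  obtain ⟨g, G, rfl, hg, hl⟩ := List.map_eq_cons_iff.1 hl
  obtain rfl := List.map_eq_nil_iff.1 hl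
  exact ⟨g, by simpa using hG, hg⟩

theorem StdPointed.exists_window_right {f : Fin (d + 1) → ℤ} {a : CoxVertex d}
    (h : StdPointed [cls f, a]) : ∃ g, Window f g ∧ cls g = a := by
  obtain ⟨g, hg, rfl⟩ := h.rotate_one.exists_window_left
  exact ⟨g + 1, hg.rotate, cls_add_one g⟩

theorem Window.stdPointed {f g : Fin (d + 1) → ℤ} (h : Window f g) : StdPointed [cls f, cls g] :=
  stdPointed_map_cls (F := [f, g]) (by simpa using h) (by simp)

/-- The first `t` coordinates in the order given by `σ`. -/
def initialSet (σ : Equiv.Perm (Fin (d + 1))) (t : ℕ) : Finset (Fin (d + 1)) :=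
  Finset.univ.filter fun i => (σ i : ℕ) < t

/-- The vertices of a chamber, as a periodic chain of vectors starting with `f`, in which the
coordinates are increased in the order given by `σ`. -/
def chamber (f : Fin (d + 1) → ℤ) (σ : Equiv.Perm (Fin (d + 1))) (t : ℕ) : Fin (d + 1) → ℤ :=
  f + ind (initialSet σ t)

theorem mem_initialSet {σ : Equiv.Perm (Fin (d + 1))} {t : ℕ} {i : Fin (d + 1)} :
    i ∈ initialSet σ t ↔ (σ i : ℕ) < t := by simp [initialSet]

theorem card_initialSet (σ : Equiv.Perm (Fin (d + 1))) {t : ℕ} (ht : t ≤ d + 1) :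
    (initialSet σ t).card = t := by
  have : initialSet σ t = (Finset.univ.filter fun i : Fin (d + 1) => (i : ℕ) < t).map
      σ.symm.toEmbedding := by
    ext i
    simp [mem_initialSet]
  rw [this, Finset.card_map, Fin.card_filter_val_lt]
  omega

theorem initialSet_zero (σ : Equiv.Perm (Fin (d + 1))) : initialSet σ 0 = ∅ := by
  simp [initialSet]

theorem initialSet_last (σ : Equiv.Perm (Fin (d + 1))) : initialSet σ (d + 1) = Finset.univ := by
  ext i
  simpa [mem_initialSet] using (σ i).is_le

theorem initialSet_ssubset (σ : Equiv.Perm (Fin (d + 1))) {s t : ℕ} (h : s < t) (ht : t ≤ d + 1) :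
    initialSet σ s ⊂ initialSet σ t := by
  refine Finset.ssubset_iff_subset_ne.2 ⟨fun i hi => ?_, fun he => ?_⟩
  · rw [mem_initialSet] at hi ⊢
    omega
  · have := congrArg Finset.card he
    rw [card_initialSet σ ht, card_initialSet σ (h.le.trans ht)] at this
    omega

theorem chamber_zero (f : Fin (d + 1) → ℤ) (σ : Equiv.Perm (Fin (d + 1))) : chamber f σ 0 = f := by
  ext i
  simp [chamber, ind, initialSet]

theorem chamber_window (f : Fin (d + 1) → ℤ) (σ : Equiv.Perm (Fin (d + 1))) {s t : ℕ} (h : s < t)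
    (ht : t ≤ d) : Window (chamber f σ s) (chamber f σ t) := by
  have h1 : ind (initialSet σ t) < (1 : Fin (d + 1) → ℤ) := by
    refine ind_lt_one fun he => ?_
    have := congrArg Finset.card he
    rw [card_initialSet σ (by omega)] at this
    simp at this
    omega
  have h2 : (0 : Fin (d + 1) → ℤ) ≤ ind (initialSet σ s) := by
    intro i
    unfold ind
    split <;> simp
  refine ⟨?_, ?_⟩
  · simpa [chamber, ind_lt_ind] using initialSet_ssubset σ h (by omega)
  · rw [chamber, chamber, add_assoc]
    refine (add_lt_add_iff_left _).2 (h1.trans_le ?_)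
    simpa using h2

/-- The pointed chamber with vertices `chamber f σ t`. -/
def chamberList (f : Fin (d + 1) → ℤ) (σ : Equiv.Perm (Fin (d + 1))) : List (CoxVertex d) :=
  ((List.range (d + 1)).map (chamber f σ)).map cls

theorem stdPointed_chamberList (f : Fin (d + 1) → ℤ) (σ : Equiv.Perm (Fin (d + 1))) :
    StdPointed (chamberList f σ) := by
  refine stdPointed_map_cls ?_ (by simp)
  rw [List.pairwise_map]
  refine List.pairwise_lt_range.imp_of_mem fun {s t} _ ht hst => chamber_window f σ hst ?_
  have := List.mem_range.1 ht
  omega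

theorem mem_chamberList {f : Fin (d + 1) → ℤ} {σ : Equiv.Perm (Fin (d + 1))} {a : CoxVertex d} :
    a ∈ chamberList f σ ↔ ∃ t ≤ d, cls (chamber f σ t) = a := by
  simp [chamberList]

/-- The sets `S t` of coordinates raised after `t` steps form a strictly increasing chain from the
empty set to all `d + 1` coordinates in `d + 1` steps. So each step adds exactly one coordinate `p
t`, and the permutation is the inverse of `p`. -/
theorem StdPointed.exists_chamberList {l : List (CoxVertex d)} (h : StdPointed l)
    (hl : l.length = d + 1) : ∃ f σ, l = chamberList f σ := by
  obtain ⟨-, F, hF, rfl⟩ := stdPointed_iff.1 h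
  rw [List.length_map] at hl
  have hw : ∀ s t (hst : s < t) (ht : t < d + 1), Window (F[s]'(by omega)) (F[t]'(by omega)) :=
    fun s t hst ht => List.pairwise_iff_getElem.1 hF s t (by omega) (by omega) hst
  set f := F[0]'(by omega) with hf
  set S : ℕ → Finset (Fin (d + 1)) := fun t => if ht : t < d + 1 then
    Finset.univ.filter (fun i => f i < (F[t]'(by omega)) i) else Finset.univ with hS
  have hS' : ∀ t (ht : t < d + 1), F[t]'(by omega) = f + ind (S t) := by
    intro t ht
    ext i
    simp only [hS, dif_pos ht, Pi.add_apply, ind, Finset.mem_filter, Finset.mem_univ, true_and]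
    rcases Nat.eq_zero_or_pos t with rfl | h0
    · simp [hf]
    · obtain ⟨h1, -, h2, -⟩ := window_iff.1 (hw 0 t h0 ht)
      have := h1 i; have := h2 i
      simp only [← hf] at *
      split <;> omega
  have hlt : ∀ t < d + 1, S t ⊂ S (t + 1) := by
    intro t ht
    by_cases ht' : t + 1 < d + 1
    · have := (hw t (t + 1) (by omega) ht').1
      rw [hS' t ht, hS' _ ht'] at this
      simpa [ind_lt_ind] using this
    · rw [Finset.ssubset_iff_subset_ne]
      have e : S (t + 1) = Finset.univ := by simp only [hS, dif_neg ht']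
      refine ⟨by simp [e], fun he => ?_⟩
      rw [e] at he
      have h1 := hS' t ht
      rcases Nat.eq_zero_or_pos t with rfl | h0
      · have := congrFun h1 0
        simp [he, ind, ← hf] at this
      · obtain ⟨j, hj⟩ := (window_iff.1 (hw 0 t h0 ht)).2.2.2
        have := congrFun h1 j
        simp only [he, ind, Pi.add_apply, Finset.mem_univ, if_true, ← hf] at this hj
        omega
  have hmono : ∀ s t, s ≤ t → t ≤ d + 1 → S s ⊆ S t := by
    intro s t hst
    induction t, hst using Nat.le_induction with
    | base => simp
    | succ t hst ih => exact fun ht => (ih (by omega)).trans (hlt t (by omega)).1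
  choose! p hp hp' using fun t (ht : t < d + 1) => Finset.exists_of_ssubset (hlt t ht)
  have hinj : Function.Injective fun t : Fin (d + 1) => p t := by
    have : ∀ s t : Fin (d + 1), s < t → p s ≠ p t := fun s t hst he =>
      hp' t t.2 (he ▸ hmono _ _ (by omega) (by omega) (hp s s.2))
    intro s t hst
    by_contra hne
    rcases lt_or_gt_of_ne hne with h | h
    · exact this s t h hst
    · exact this t s h hst.symm
  let τ : Equiv.Perm (Fin (d + 1)) := Equiv.ofBijective _ (Finite.injective_iff_bijective.1 hinj)
  refine ⟨f, τ.symm, ?_⟩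
  unfold chamberList
  congr 1
  refine List.ext_getElem (by simp [hl]) fun t h1 h2 => ?_
  have ht : t < d + 1 := by omega
  rw [List.getElem_map, List.getElem_range, hS' t ht, chamber]
  congr 2
  ext i
  obtain ⟨s, rfl⟩ := τ.surjective i
  rw [mem_initialSet, Equiv.symm_apply_apply]
  change p s ∈ S t ↔ _
  constructor
  · intro h
    by_contra hts
    exact hp' s s.2 (hmono _ _ (by omega) (by omega) h)
  · intro h
    exact hmono (s + 1) t (by omega) (by omega) (hp s s.2)

/-! ### Rigidity -/

/-- The lift of `cls g'` in the window above `g` is `g' + c` for a constant `c`, and the windows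
above `f` leave only `c = 0` (then `g < g'`) and `c = 1` (then `g' < g`). -/
theorem StdPointed.lt_or_lt {f g g' : Fin (d + 1) → ℤ} (hg : Window f g) (hg' : Window f g')
    (h : StdPointed [cls g, cls g']) : g < g' ∨ g' < g := by
  obtain ⟨k, hk, hc⟩ := h.exists_window_right
  obtain ⟨c, hc⟩ := cls_eq_iff.1 hc.symm
  have hne := h.nodup
  obtain ⟨h1, ⟨i1, h2⟩, h3, j1, h4⟩ := window_iff.1 hg
  obtain ⟨h1', ⟨i2, h2'⟩, h3', j2, h4'⟩ := window_iff.1 hg'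
  obtain ⟨h1k, ⟨i3, h2k⟩, h3k, j3, h4k⟩ := window_iff.1 hk
  have hc0 : 0 ≤ c := by
    have := hc j2; have := h1k j2; have := h1 j2
    omega
  have hc1 : c ≤ 1 := by
    have := hc i2; have := h3k i2; have := h3 i2
    omega
  obtain rfl | rfl : c = 0 ∨ c = 1 := by omega
  · left
    have : k = g' := by ext i; simp [hc]
    exact this ▸ hk.1
  · right
    refine lt_of_le_of_ne (fun i => ?_) fun he => ?_
    · have := hc i; have := h3k i
      change g' i ≤ g i
      omega
    · simp [he] at hne

/-- A panel of an apartment lies in just two chambers. Here `g = f + ind J` with `J` strictly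
comparable to every other proper nonempty initial set. Hence `J` has `i + 1` elements and lies
between the initial sets of sizes `i` and `i + 2`, which leaves two choices. -/
theorem eq_or_eq_of_flip {f g : Fin (d + 1) → ℤ} {σ : Equiv.Perm (Fin (d + 1))} (i : Fin d)
    (hg : Window f g)
    (h : ∀ s, 1 ≤ s → s ≤ d → s ≠ i + 1 → StdPointed [cls (chamber f σ s), cls g]) :
    g = chamber f σ (i + 1) ∨
      g = chamber f (Equiv.swap i.castSucc i.succ * σ) (i + 1) := by
  obtain ⟨J, hJ, hJ', rfl⟩ := hg.exists_ind
  have hcmp : ∀ s, 1 ≤ s → s ≤ d → s ≠ i + 1 → initialSet σ s ⊂ J ∨ J ⊂ initialSet σ s := by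
    intro s h1 h2 h3
    have hw := chamber_window f σ (s := 0) (t := s) (by omega) h2
    rw [chamber_zero] at hw
    simpa [chamber, ind_lt_ind] using (h s h1 h2 h3).lt_or_lt hw hg
  have hcard : 1 ≤ J.card := hJ.card_pos
  have hcard' : J.card ≤ d := by
    have := Finset.card_lt_univ_of_notMem (s := J)
      (Classical.choose_spec (by simpa [Finset.eq_univ_iff_forall] using hJ'))
    simp at this
    omega
  have hJi : J.card = i + 1 := by
    by_contra hne
    have h1 := card_initialSet σ (t := J.card) (by omega)
    rcases hcmp _ hcard hcard' hne with h | h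
    all_goals
      have := Finset.card_lt_card h
      omega
  have hsub : J ⊆ initialSet σ (i + 2) := by
    by_cases hid : (i : ℕ) + 2 ≤ d
    · rcases hcmp (i + 2) (by omega) hid (by omega) with h | h
      · have := Finset.card_lt_card h
        rw [card_initialSet σ (by omega)] at this
        omega
      · exact h.1
    · have : (i : ℕ) + 2 = d + 1 := by omega
      rw [this, initialSet_last]
      exact Finset.subset_univ _
  have hsup : initialSet σ i ⊆ J := by
    by_cases hid : 1 ≤ (i : ℕ)
    · rcases hcmp i (by omega) (by omega) (by omega) with h | h
      · exact h.1
      · have := Finset.card_lt_card h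
        rw [card_initialSet σ (by omega)] at this
        omega
    · have : (i : ℕ) = 0 := by omega
      rw [this, initialSet_zero]
      exact Finset.empty_subset _
  by_cases hi : σ.symm i.castSucc ∈ J
  · left
    rw [chamber]
    congr 2
    refine (Finset.eq_of_subset_of_card_le (fun j hj => ?_) ?_).symm
    · rw [mem_initialSet] at hj
      by_cases hj' : (σ j : ℕ) = i
      · have : j = σ.symm i.castSucc := by
          rw [Equiv.eq_symm_apply]
          exact Fin.ext hj'
        exact this ▸ hi
      · exact hsup (mem_initialSet.2 (by omega))
    · rw [hJi, card_initialSet σ (by omega)]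
  · right
    rw [chamber]
    congr 2
    refine Finset.eq_of_subset_of_card_le (fun j hj => ?_) ?_
    · have h1 := mem_initialSet.1 (hsub hj)
      have h2 : (σ j : ℕ) ≠ i := by
        intro h2
        apply hi
        have : σ.symm i.castSucc = j := by
          rw [Equiv.symm_apply_eq]
          exact Fin.ext h2.symm
        exact this ▸ hj
      rw [mem_initialSet, Equiv.Perm.mul_apply]
      by_cases h3 : σ j = i.succ
      · rw [h3, Equiv.swap_apply_right]
        simp
      · rw [Equiv.swap_apply_of_ne_of_ne (fun h => h2 (by simp [h])) h3]
        have : (σ j : ℕ) ≠ i + 1 := fun h => h3 (Fin.ext h)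
        omega
    · rw [hJi, card_initialSet _ (by omega)]

theorem chamber_swap_mul {f : Fin (d + 1) → ℤ} {σ : Equiv.Perm (Fin (d + 1))} (i : Fin d) {s : ℕ}
    (hs : s ≠ i + 1) :
    chamber f (Equiv.swap i.castSucc i.succ * σ) s = chamber f σ s := by
  rw [chamber, chamber]
  congr 2
  ext j
  rw [mem_initialSet, mem_initialSet, Equiv.Perm.mul_apply]
  by_cases h1 : σ j = i.castSucc
  · rw [h1, Equiv.swap_apply_left]
    simp
    omega
  by_cases h2 : σ j = i.succ
  · rw [h2, Equiv.swap_apply_right]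
    simp
    omega
  rw [Equiv.swap_apply_of_ne_of_ne h1 h2]

theorem chamber_swap_ne {f : Fin (d + 1) → ℤ} {σ : Equiv.Perm (Fin (d + 1))} (i : Fin d) :
    chamber f (Equiv.swap i.castSucc i.succ * σ) (i + 1) ≠ chamber f σ (i + 1) := by
  intro h
  have := congrFun h (σ.symm i.castSucc)
  simp [chamber, ind, mem_initialSet, Equiv.Perm.mul_apply] at this

theorem chamber_swap_one (f : Fin (d + 1) → ℤ) (i : Fin (d + 1)) :
    chamber f (Equiv.swap i 0) 1 = f + Pi.single i 1 := by
  ext j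
  have : (Equiv.swap i 0 j : ℕ) < 1 ↔ j = i := by
    rw [Nat.lt_one_iff, Fin.val_eq_zero_iff, Equiv.swap_apply_eq_iff, Equiv.swap_apply_right]
  simp [chamber, ind, mem_initialSet, this, Pi.single_apply]

/-- Rotating the enumeration of a chamber changes its base vector; for `t = d` the right side is `f
+ 1`, of the same class as `f`. -/
theorem chamber_finRotate (f : Fin (d + 1) → ℤ) (σ : Equiv.Perm (Fin (d + 1))) {t : ℕ}
    (ht : t ≤ d) :
    chamber (chamber f σ 1) ((finRotate (d + 1))⁻¹ * σ) t = chamber f σ (t + 1) := by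
  ext j
  obtain ⟨s, hs⟩ : ∃ s, finRotate (d + 1) s = σ j := (finRotate (d + 1)).surjective _
  have : ((finRotate (d + 1))⁻¹ * σ) j = s := by
    rw [Equiv.Perm.mul_apply, ← hs, Equiv.Perm.inv_def, Equiv.symm_apply_apply]
  simp only [chamber, ind, Pi.add_apply, mem_initialSet, this, ← hs]
  rcases eq_or_ne s (Fin.last d) with rfl | hl
  · rw [finRotate_last]
    simp
    omega
  · have h2 : (s : ℕ) < d := lt_of_le_of_ne (by omega) fun h => hl (Fin.ext h)
    rw [finRotate_of_lt h2]
    simp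

/-- The property of being fixed spreads along galleries. Crossing a panel based at `f` corresponds
to an adjacent transposition, and these generate all permutations, so every chamber based at `f` is
fixed. Rotation then moves the base from `f` to `f + e_i`, and such steps reach every vertex. -/
theorem rigid {ψ : CoxVertex d → CoxVertex d} (hψ : Function.Injective ψ)
    (hadj : ∀ a b, StdPointed [a, b] → StdPointed [ψ a, ψ b]) {f : Fin (d + 1) → ℤ}
    {σ : Equiv.Perm (Fin (d + 1))} (h : ∀ a ∈ chamberList f σ, ψ a = a) (a : CoxVertex d) :
    ψ a = a := by
  let good : (Fin (d + 1) → ℤ) → Equiv.Perm (Fin (d + 1)) → Prop := fun f σ =>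
    ∀ t ≤ d, ψ (cls (chamber f σ t)) = cls (chamber f σ t)
  have hflip : ∀ f σ (i : Fin d), good f σ → good f (Equiv.swap i.castSucc i.succ * σ) := by
    intro f σ i hg t ht
    set σ' := Equiv.swap i.castSucc i.succ * σ with hσ'
    have hfix : ∀ s ≤ d, s ≠ i + 1 → ψ (cls (chamber f σ' s)) = cls (chamber f σ' s) := by
      intro s hs hsi
      rw [hσ', chamber_swap_mul i hsi]
      exact hg s hs
    by_cases hti : t = i + 1
    swap
    · exact hfix t ht hti
    subst hti
    have hpt : ∀ s ≤ d, s ≠ i + 1 →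
        StdPointed [cls (chamber f σ' s), ψ (cls (chamber f σ' (i + 1)))] := by
      intro s hs hsi
      have key : StdPointed [cls (chamber f σ' s), cls (chamber f σ' (i + 1))] := by
        rcases lt_or_gt_of_ne hsi with hlt | hlt
        · exact (chamber_window f σ' hlt ht).stdPointed
        · exact (chamber_window f σ' hlt hs).stdPointed.rotate_one
      have := hadj _ _ key
      rwa [hfix s hs hsi] at this
    have h0 := hpt 0 (by omega) (by omega)
    rw [chamber_zero] at h0
    obtain ⟨g, hg1, hg2⟩ := h0.exists_window_right
    rw [← hg2] at hpt ⊢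
    rcases eq_or_eq_of_flip (σ := σ) i hg1 (fun s h1 h2 h3 => by
      have := hpt s h2 h3
      rwa [hσ', chamber_swap_mul i h3] at this) with h | h
    -- Folding is impossible: the old vertex is its own image, so by injectivity it is not the image
    -- of the new one.
    · exfalso
      have h1 := hg (i + 1) ht
      rw [← h] at h1
      have h2 := hψ (h1.trans hg2)
      rw [h] at h2
      refine chamber_swap_ne (f := f) (σ := σ) i ?_
      have w1 := chamber_window f σ (s := 0) (t := i + 1) (by omega) ht
      have w2 := chamber_window f σ' (s := 0) (t := i + 1) (by omega) ht
      rw [chamber_zero] at w1 w2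
      exact w2.eq_right w1 h2.symm
    · rw [h]
  have hall : ∀ f σ τ, good f σ → good f (τ * σ) := by
    intro f σ τ
    have hτ : τ ∈ Submonoid.closure (Set.range fun i : Fin d => Equiv.swap i.castSucc i.succ) := by
      rw [Equiv.Perm.mclosure_swap_castSucc_succ]
      trivial
    induction hτ using Submonoid.closure_induction generalizing σ with
    | mem x hx =>
      obtain ⟨i, rfl⟩ := hx
      exact hflip f σ i
    | one => simp
    | mul x y _ _ hx hy =>
      intro h
      rw [mul_assoc]
      exact hx _ (hy _ h)
  let S : Set (Fin (d + 1) → ℤ) := {f | ∀ σ, good f σ}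
  have hS : ∀ f σ, good f σ → f ∈ S := fun f σ h τ => by
    simpa using hall f σ (τ * σ⁻¹) h
  have hstep : ∀ f ∈ S, ∀ i, f + Pi.single i 1 ∈ S := by
    intro f hf i
    set σ := Equiv.swap i 0 with hσ
    have he : chamber f σ 1 = f + Pi.single i 1 := chamber_swap_one f i
    rw [← he]
    refine hS _ ((finRotate (d + 1))⁻¹ * σ) fun t ht => ?_
    rw [chamber_finRotate f σ ht]
    rcases ht.eq_or_lt with rfl | ht
    · have : chamber f σ (t + 1) = f + 1 := by
        rw [chamber, initialSet_last]
        ext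
        simp [ind]
      rw [this, cls_add_one]
      simpa [chamber_zero] using hf σ 0 (by omega)
    · exact hf σ (t + 1) ht
  have hmany : ∀ n : ℕ, ∀ f ∈ S, ∀ g, f ≤ g → ∑ i, (g i - f i) = n → g ∈ S := by
    intro n
    induction n with
    | zero =>
      intro f hf g hfg hs
      have := (Finset.sum_eq_zero_iff_of_nonneg (f := fun i => g i - f i) (s := Finset.univ)
        (fun i _ => sub_nonneg.2 (hfg i))).1 (by exact_mod_cast hs)
      have : f = g := by
        ext i
        have := this i (Finset.mem_univ i)
        omega
      exact this ▸ hf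
    | succ n ih =>
      intro f hf g hfg hs
      obtain ⟨i, hi⟩ : ∃ i, f i < g i := by
        by_contra! hcon
        have : ∑ i, (g i - f i) ≤ 0 := Finset.sum_nonpos fun i _ => by
          have := hcon i
          omega
        push_cast at hs
        omega
      refine ih _ (hstep f hf i) g (fun j => ?_) ?_
      · have : f j ≤ g j := hfg j
        rw [Pi.add_apply, Pi.single_apply]
        split_ifs with h
        · subst h
          exact Int.add_one_le_of_lt hi
        · rwa [add_zero]
      · simp only [Pi.add_apply, ← sub_sub, Finset.sum_sub_distrib (f := fun i => g i - f i), hs]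
        simp
  obtain ⟨g, rfl⟩ := cls_surjective a
  have hf : f ∈ S := hS f σ fun t ht => h _ (mem_chamberList.2 ⟨t, ht, rfl⟩)
  -- Adding a constant does not change the class, so the target may be assumed to lie above `f`.
  obtain ⟨c, hc⟩ : ∃ c : ℤ, ∀ i, f i ≤ g i + c := by
    refine ⟨∑ i, |f i - g i|, fun i => ?_⟩
    have this := Finset.single_le_sum (f := fun i => |f i - g i|) (fun i _ => abs_nonneg _)
      (Finset.mem_univ i)
    have h2 := le_abs_self (f i - g i)
    have h3 : |f i - g i| ≤ ∑ i, |f i - g i| := this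
    omega
  have hg : (fun i => g i + c) ∈ S := by
    refine hmany (∑ i, (g i + c - f i)).toNat f hf _ hc ?_
    rw [Int.toNat_of_nonneg]
    exact Finset.sum_nonneg fun i _ => by simpa using hc i
  have := hg 1 0 (by omega)
  rw [chamber_zero] at this
  rwa [cls_eq_iff.2 ⟨c, fun i => rfl⟩]

/-! ### Affine automorphisms of the Coxeter complex -/

/-- The map of the Coxeter complex induced by a permutation of the coordinates, followed by a
translation. -/
noncomputable def affine (f : Fin (d + 1) → ℤ) (σ : Equiv.Perm (Fin (d + 1))) (a : CoxVertex d) :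
    CoxVertex d :=
  cls fun i => f i + (Quotient.out a : Fin (d + 1) → ℤ) (σ i)

theorem affine_cls (f : Fin (d + 1) → ℤ) (σ : Equiv.Perm (Fin (d + 1))) (v : Fin (d + 1) → ℤ) :
    affine f σ (cls v) = cls fun i => f i + v (σ i) := by
  have : cls v = cls (Quotient.out (cls v) : Fin (d + 1) → ℤ) :=
    (Quotient.out_eq (cls v)).symm
  obtain ⟨c, hc⟩ := cls_eq_iff.1 this
  exact (cls_eq_iff.2 ⟨c, fun i => by rw [hc]; ring⟩).symm

theorem StdPointed.affine {l : List (CoxVertex d)} (h : StdPointed l) (f : Fin (d + 1) → ℤ)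
    (σ : Equiv.Perm (Fin (d + 1))) : StdPointed (l.map (affine f σ)) := by
  obtain ⟨hne, F, hF, rfl⟩ := stdPointed_iff.1 h
  refine stdPointed_iff.2 ⟨by simpa using hne, F.map fun v i => f i + v (σ i), ?_, ?_⟩
  · rw [List.pairwise_map]
    refine hF.imp fun {v w} h => ?_
    rw [window_iff] at h ⊢
    obtain ⟨h1, ⟨i, hi⟩, h2, j, hj⟩ := h
    refine ⟨fun i => ?_, ⟨σ.symm i, ?_⟩, fun i => ?_, σ.symm j, ?_⟩
    · have := h1 (σ i); omega
    · rw [Equiv.apply_symm_apply]; omega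
    · have := h2 (σ i); omega
    · rw [Equiv.apply_symm_apply]; omega
  · simp only [List.map_map]
    exact List.map_congr_left fun v _ => (affine_cls f σ v).symm

theorem affine_leftInverse (f : Fin (d + 1) → ℤ) (σ : Equiv.Perm (Fin (d + 1))) (a : CoxVertex d) :
    affine (fun i => - f (σ.symm i)) σ.symm (affine f σ a) = a := by
  obtain ⟨v, rfl⟩ := cls_surjective a
  rw [affine_cls, affine_cls]
  congr 1
  ext i
  simp

theorem affine_rightInverse (f : Fin (d + 1) → ℤ) (σ : Equiv.Perm (Fin (d + 1)))
    (a : CoxVertex d) : affine f σ (affine (fun i => - f (σ.symm i)) σ.symm a) = a := by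
  simpa using affine_leftInverse (fun i => - f (σ.symm i)) σ.symm a

theorem stdPointed_map_affine {l : List (CoxVertex d)} {f : Fin (d + 1) → ℤ}
    {σ : Equiv.Perm (Fin (d + 1))} : StdPointed (l.map (affine f σ)) ↔ StdPointed l := by
  refine ⟨fun h => ?_, fun h => h.affine f σ⟩
  have := h.affine (fun i => - f (σ.symm i)) σ.symm
  rw [List.map_map] at this
  rwa [Function.LeftInverse.comp_eq_id (affine_leftInverse f σ), List.map_id] at this

theorem affine_bijective (f : Fin (d + 1) → ℤ) (σ : Equiv.Perm (Fin (d + 1))) :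
    Function.Bijective (affine f σ) :=
  ⟨Function.LeftInverse.injective (affine_leftInverse f σ),
    Function.RightInverse.surjective (affine_rightInverse f σ)⟩

theorem chamberList_eq_map_affine (f : Fin (d + 1) → ℤ) (σ : Equiv.Perm (Fin (d + 1))) :
    chamberList f σ = (chamberList 0 1).map (affine f σ) := by
  unfold chamberList
  rw [List.map_map, List.map_map, List.map_map]
  refine List.map_congr_left fun t _ => ?_
  simp only [Function.comp, affine_cls]
  congr 1
  ext i
  simp [chamber, ind, mem_initialSet]

/-- The affine automorphisms act transitively on pointed chambers. -/
theorem exists_automorphism_chamberList (f f' : Fin (d + 1) → ℤ)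
    (σ σ' : Equiv.Perm (Fin (d + 1))) : ∃ e : CoxVertex d → CoxVertex d, Function.Bijective e ∧
      (∀ l, StdPointed (l.map e) ↔ StdPointed l) ∧
      (chamberList f σ).map e = chamberList f' σ' := by
  refine ⟨affine f' σ' ∘ affine (fun i => - f (σ.symm i)) σ.symm,
    (affine_bijective _ _).comp (affine_bijective _ _), fun l => ?_, ?_⟩
  · rw [← List.map_map, stdPointed_map_affine, stdPointed_map_affine]
  · rw [chamberList_eq_map_affine f, chamberList_eq_map_affine f', List.map_map]
    refine List.map_congr_left fun a _ => ?_
    simp [affine_leftInverse]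

/-! ### Heights -/

/-- A vector is normalized if its minimal coordinate is `0`. -/
def Normalized (f : Fin (d + 1) → ℤ) : Prop := (∀ i, 0 ≤ f i) ∧ ∃ i, f i = 0

theorem exists_normalized (a : CoxVertex d) : ∃ f, Normalized f ∧ cls f = a := by
  obtain ⟨f, rfl⟩ := cls_surjective a
  obtain ⟨i, hi⟩ := Finite.exists_min f
  refine ⟨fun j => f j - f i, ⟨fun j => by simpa using hi j, i, by simp⟩,
    (cls_eq_iff.2 ⟨- f i, fun j => by ring⟩).symm⟩

theorem Normalized.eq {f g : Fin (d + 1) → ℤ} (hf : Normalized f) (hg : Normalized g)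
    (h : cls f = cls g) : f = g := by
  obtain ⟨c, hc⟩ := cls_eq_iff.1 h
  obtain ⟨h1, i, h2⟩ := hf
  obtain ⟨h3, j, h4⟩ := hg
  have := hc i; have := hc j; have := h1 j; have := h3 i
  ext k
  have := hc k
  omega

/-- The distance of a vertex from the vertex `0`: the sum of the coordinates of its normalized
representative. -/
noncomputable def height (a : CoxVertex d) : ℕ := (∑ i, (exists_normalized a).choose i).toNat

theorem height_cls {f : Fin (d + 1) → ℤ} (hf : Normalized f) : (height (cls f) : ℤ) = ∑ i, f i := by
  obtain ⟨h1, h2⟩ := (exists_normalized (cls f)).choose_spec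
  rw [height, h1.eq hf h2, Int.toNat_of_nonneg (Finset.sum_nonneg fun i _ => hf.1 i)]

theorem sum_lt_sum_of_lt {f g : Fin (d + 1) → ℤ} (h : f < g) : ∑ i, f i < ∑ i, g i := by
  obtain ⟨h1, i, h2⟩ := Pi.lt_def.1 h
  exact Finset.sum_lt_sum (fun i _ => h1 i) ⟨i, Finset.mem_univ i, h2⟩

theorem height_lt_height {f g : Fin (d + 1) → ℤ} (hf : Normalized f) (hg : Normalized g)
    (h : f < g) : height (cls f) < height (cls g) := by
  have := height_cls hf
  have := height_cls hg
  have : ∑ i, f i < ∑ i, g i := sum_lt_sum_of_lt h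
  omega

/-- If `g` has no zero coordinate, it is at least `1` everywhere and equal to `1` where `f`
vanishes; so `g - 1` is the normalized representative, and it lies below `f`. -/
theorem Window.normalized_cases {f g : Fin (d + 1) → ℤ} (hf : Normalized f) (h : Window f g) :
    (Normalized g ∧ height (cls f) < height (cls g)) ∨
      (Normalized (g - 1) ∧ height (cls g) < height (cls f)) := by
  obtain ⟨h1, i, h2⟩ := hf
  have h3 := (window_iff.1 h).1
  have h4 := (window_iff.1 h).2.2.1
  by_cases hg : ∃ i, g i = 0
  · have hg' : Normalized g := ⟨fun i => (h1 i).trans (h3 i), hg⟩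
    exact .inl ⟨hg', height_lt_height ⟨h1, i, h2⟩ hg' h.1⟩
  · push Not at hg
    have hg' : Normalized (g - 1) := by
      refine ⟨fun j => ?_, i, ?_⟩
      · have := h1 j; have := h3 j; have := hg j
        simp only [Pi.sub_apply, Pi.one_apply]
        omega
      · have := h3 i; have := h4 i; have := hg i
        simp only [Pi.sub_apply, Pi.one_apply]
        omega
    have := height_lt_height hg' ⟨h1, i, h2⟩ h.unrotate.1
    rw [← cls_add_one (g - 1), sub_add_cancel] at this
    exact .inr ⟨hg', this⟩

theorem StdPointed.exists_lift_cons {f : Fin (d + 1) → ℤ} {l : List (CoxVertex d)}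
    (h : StdPointed (cls f :: l)) :
    ∃ G : List (Fin (d + 1) → ℤ), (f :: G).Pairwise Window ∧ G.map cls = l := by
  obtain ⟨-, F, hF, hl⟩ := stdPointed_iff.1 h
  obtain ⟨g, G, rfl, hg, rfl⟩ := List.map_eq_cons_iff.1 hl
  obtain ⟨c, rfl, hc⟩ := exists_const_of_cls_eq hg
  refine ⟨G.map (· + c), by simpa using pairwise_window_add hF c, ?_⟩
  rw [List.map_map]
  exact List.map_congr_left fun k _ => hc k

/-- Start from the normalized lift of `a`. Since the height grows, the lift of `c` above it still
has a zero coordinate; the lift of `b` is squeezed below it and vanishes there too. -/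
theorem StdPointed.height_between {a b c : CoxVertex d} (h : StdPointed [a, b, c])
    (hac : height a < height c) : height a < height b ∧ height b < height c := by
  obtain ⟨f, hf, rfl⟩ := exists_normalized a
  obtain ⟨G, hG, hl⟩ := h.exists_lift_cons
  obtain ⟨g, G', rfl, rfl, hl'⟩ := List.map_eq_cons_iff.1 hl
  obtain ⟨k, G, rfl, rfl, hl''⟩ := List.map_eq_cons_iff.1 hl'
  obtain rfl := List.map_eq_nil_iff.1 hl''
  simp only [List.pairwise_cons, List.mem_cons, List.not_mem_nil, or_false, forall_eq_or_imp,
    forall_eq] at hG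
  obtain ⟨⟨h1, h2⟩, h3, -⟩ := hG
  rcases h2.normalized_cases hf with ⟨hk, -⟩ | ⟨-, h⟩
  swap
  · omega
  obtain ⟨hk1, i, hi⟩ := hk
  have hg : Normalized g := by
    have h4 := (window_iff.1 h1).1
    have h5 := (window_iff.1 h3).1
    refine ⟨fun j => (hf.1 j).trans (h4 j), i, ?_⟩
    have := h4 i; have := h5 i; have := hf.1 i
    omega
  exact ⟨height_lt_height hf hg h1.1, height_lt_height hg ⟨hk1, i, hi⟩ h3.1⟩

/-- In a lift with normalized first vector every member `g` is normalized or has `g - 1` normalized.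
Replacing the latter by `g - 1` and putting them in front is a rotation, and along a chain of
normalized vectors the height increases. -/
theorem StdPointed.exists_sorted {l : List (CoxVertex d)} (h : StdPointed l) :
    ∃ l', StdPointed l' ∧ (∀ a, a ∈ l' ↔ a ∈ l) ∧ l'.Pairwise (height · < height ·) := by
  classical
  obtain ⟨a, l, rfl⟩ := List.exists_cons_of_ne_nil h.ne_nil
  obtain ⟨f, hf, rfl⟩ := exists_normalized a
  obtain ⟨G, hG, rfl⟩ := h.exists_lift_cons
  clear h
  set F := f :: G with hF
  have hFne : F ≠ [] := by simp [hF]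
  have hcase : ∀ g ∈ F, Normalized g ∨ Normalized (g - 1) := by
    intro g hg
    rcases List.mem_cons.1 hg with rfl | hg
    · exact .inl hf
    · exact (((List.pairwise_cons.1 hG).1 g hg).normalized_cases hf).imp (·.1) (·.1)
  have hnot : ∀ g : Fin (d + 1) → ℤ, Normalized g → ¬ Normalized (g - 1) := by
    rintro g ⟨-, i, hi⟩ ⟨h, -⟩
    have := h i
    simp [hi] at this
  set P := F.filter (fun g => Normalized g) with hP
  set Q := F.filter (fun g => Normalized (g - 1)) with hQ
  have hP' : ∀ g ∈ P, g ∈ F ∧ Normalized g := fun g hg => by simpa [hP] using hg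
  have hQ' : ∀ g ∈ Q, g ∈ F ∧ Normalized (g - 1) := fun g hg => by simpa [hQ] using hg
  set L := Q.map (· + (-1)) ++ P with hL
  have hLw : L.Pairwise Window := by
    rw [hL, List.pairwise_append]
    refine ⟨pairwise_window_add (hG.sublist List.filter_sublist) _,
      hG.sublist List.filter_sublist, fun x hx g hg => ?_⟩
    obtain ⟨k, hk, rfl⟩ := List.mem_map.1 hx
    obtain ⟨hk1, hk2⟩ := hQ' k hk
    obtain ⟨hg1, hg2⟩ := hP' g hg
    rw [← sub_eq_add_neg]
    rcases pairwise_window_of_subset hG hk1 hg1 with rfl | h | h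
    · exact absurd hk2 (hnot _ hg2)
    · exfalso
      obtain ⟨i, hi⟩ := hg2.2
      have h1 := (window_iff.1 h).1 i
      have h2 := hk2.1 i
      simp only [Pi.sub_apply, Pi.one_apply] at h2
      omega
    · exact h.unrotate
  have hLn : ∀ g ∈ L, Normalized g := by
    intro g hg
    rcases List.mem_append.1 hg with hg | hg
    · obtain ⟨k, hk, rfl⟩ := List.mem_map.1 hg
      rw [← sub_eq_add_neg]
      exact (hQ' k hk).2
    · exact (hP' g hg).2
  have hmem : ∀ a, a ∈ L.map cls ↔ a ∈ F.map cls := by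
    intro a
    have hc : ∀ k : Fin (d + 1) → ℤ, cls (k + (-1)) = cls k := fun k => by
      rw [← cls_add_one, neg_add_cancel_right]
    simp only [List.mem_map, hL, List.mem_append]
    constructor
    · rintro ⟨g, ⟨k, hk, rfl⟩ | hg, rfl⟩
      · exact ⟨k, (hQ' k hk).1, (hc k).symm⟩
      · exact ⟨g, (hP' g hg).1, rfl⟩
    · rintro ⟨g, hg, rfl⟩
      rcases hcase g hg with h | h
      · exact ⟨g, .inr (by simp [hP, hg, h]), rfl⟩
      · exact ⟨g + (-1), .inl ⟨g, by simp [hQ, hg, h], rfl⟩, hc g⟩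
  refine ⟨L.map cls, stdPointed_map_cls hLw ?_, by simpa [hF] using hmem, ?_⟩
  · rintro he
    have := (hmem (cls f)).2 (by simp [hF])
    simp [he] at this
  · rw [List.pairwise_map]
    exact hLw.imp_of_mem fun {x y} hx hy h => height_lt_height (hLn x hx) (hLn y hy) h.1

theorem exists_initialSet_eq (J : Finset (Fin (d + 1))) : ∃ σ, initialSet σ J.card = J := by
  classical
  have hJ : J.card ≤ d + 1 := by simpa using Finset.card_le_univ J
  have hc : Fintype.card {i // i ∈ J} =
      Fintype.card {i : Fin (d + 1) // (i : ℕ) < J.card} := by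
    rw [Fintype.card_subtype, Fintype.card_subtype, Fin.card_filter_val_lt]
    simp only [Finset.filter_univ_mem]
    omega
  refine ⟨(Fintype.equivOfCardEq hc).extendSubtype, ?_⟩
  ext i
  rw [mem_initialSet]
  constructor
  · intro h
    by_contra hi
    exact (Fintype.equivOfCardEq hc).extendSubtype_not_mem i hi h
  · exact (Fintype.equivOfCardEq hc).extendSubtype_mem i

/-- Among the neighbours of a vertex `a` which are closer to `0` than `a`, there is one which
precedes all others. -/
theorem exists_projection (a : CoxVertex d) (ha : height a ≠ 0) : ∃ p,
    StdPointed [p, a] ∧ height p < height a ∧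
      (∃ f σ, p ∈ chamberList f σ ∧ a ∈ chamberList f σ) ∧
      ∀ b, StdPointed [b, a] → height b < height a → p = b ∨ StdPointed [p, b, a] := by
  obtain ⟨f, hf, rfl⟩ := exists_normalized a
  -- Nearer neighbours of `f` are the vectors in the window above `f` without zero coordinate; the
  -- least of them raises exactly the zero coordinates of `f`.
  set J := Finset.univ.filter fun i => f i = 0 with hJ
  obtain ⟨σ, hσ⟩ := exists_initialSet_eq J
  have hJ1 : J.Nonempty := hf.2.imp fun i hi => by simpa [hJ] using hi
  have hJ2 : J ≠ Finset.univ := by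
    intro h
    have h0 : ∀ i, f i = 0 := fun i => by
      have := Finset.mem_univ i
      rw [← h] at this
      simpa [hJ] using this
    have := height_cls hf
    simp only [h0, Finset.sum_const_zero] at this
    omega
  have hw := window_add_ind (f := f) hJ1 hJ2
  have hJd : J.card ≤ d := by
    have := Finset.card_lt_card (Finset.ssubset_univ_iff.2 hJ2)
    simp at this
    omega
  refine ⟨cls (f + ind J), hw.stdPointed.rotate_one, ?_,
    ⟨f, σ, mem_chamberList.2 ⟨J.card, hJd, by rw [chamber, hσ]⟩,
      mem_chamberList.2 ⟨0, by omega, by rw [chamber_zero]⟩⟩, ?_⟩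
  · rcases hw.normalized_cases hf with ⟨⟨-, i, hi⟩, -⟩ | ⟨-, h⟩
    · exfalso
      have := hf.1 i
      simp only [Pi.add_apply, ind, hJ, Finset.mem_filter, Finset.mem_univ, true_and] at hi
      split_ifs at hi <;> omega
    · exact h
  · intro b hb hba
    obtain ⟨g, hg, rfl⟩ := hb.rotate_one.exists_window_right
    rcases hg.normalized_cases hf with ⟨-, h⟩ | ⟨hn, -⟩
    · omega
    have hle : f + ind J ≤ g := by
      intro i
      have h1 := hn.1 i
      have h2 := (window_iff.1 hg).1 i
      simp only [Pi.sub_apply, Pi.one_apply] at h1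
      simp only [Pi.add_apply, ind, hJ, Finset.mem_filter, Finset.mem_univ, true_and]
      split_ifs <;> omega
    rcases hle.eq_or_lt with h | h
    · exact .inl (by rw [h])
    · right
      rw [← cls_add_one f]
      refine stdPointed_map_cls (F := [f + ind J, g, f + 1]) ?_ (by simp)
      have : Window (f + ind J) g := by
        refine ⟨h, hg.2.trans ?_⟩
        simpa using ind_pos hJ1
      simp [hw.rotate, hg.rotate, this]

/-! ### Behaviour of the height along edges and under simplicial maps -/

/-- On the normalized representative the sum grows by one, unless the raised coordinate was the only
zero; then subtracting `1` everywhere renormalizes and the sum does not grow. -/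
theorem height_cls_add_single_le (f : Fin (d + 1) → ℤ) (i : Fin (d + 1)) :
    height (cls (f + Pi.single i 1)) ≤ height (cls f) + 1 := by
  obtain ⟨f', hf', hc⟩ := exists_normalized (cls f)
  obtain ⟨c, rfl, hc'⟩ := exists_const_of_cls_eq hc
  rw [hc', add_right_comm, hc']
  generalize f' = f at *
  have h := height_cls hf'
  by_cases hn : Normalized (f + Pi.single i 1)
  · have := height_cls hn
    simp only [Pi.add_apply, Finset.sum_add_distrib, Finset.sum_pi_single', Finset.mem_univ,
      if_true] at this
    omega
  · obtain ⟨h0, k, hk⟩ := hf'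
    have hki : k = i := by
      by_contra hki
      refine hn ⟨fun j => ?_, k, ?_⟩
      · have := h0 j
        rw [Pi.add_apply, Pi.single_apply]
        split_ifs <;> omega
      · simp [hki, hk]
    subst hki
    have hn' : Normalized (f + Pi.single k 1 - 1) := by
      refine ⟨fun j => ?_, k, by simp [hk]⟩
      simp only [Pi.sub_apply, Pi.add_apply, Pi.single_apply, Pi.one_apply]
      split_ifs with hj
      · subst hj; omega
      · by_contra hlt
        refine hn ⟨fun j => ?_, j, ?_⟩
        · have := h0 j
          rw [Pi.add_apply, Pi.single_apply]
          split_ifs <;> omega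
        · have := h0 j
          rw [Pi.add_apply, Pi.single_apply, if_neg hj]
          omega
    have h1 := height_cls hn'
    rw [← cls_add_one, sub_add_cancel] at h1
    have h2 : ∑ i, (f + Pi.single k 1 - 1 : Fin (d + 1) → ℤ) i ≤ ∑ i, f i := by
      refine Finset.sum_le_sum fun j _ => ?_
      simp only [Pi.sub_apply, Pi.add_apply, Pi.single_apply, Pi.one_apply]
      split_ifs <;> omega
    omega

/-- Maps preserving pointed simplices and the vertex `0` do not increase the height. -/
theorem height_map_le {e : CoxVertex d → CoxVertex d}
    (he : ∀ l, StdPointed l → StdPointed (l.map e)) (he0 : e (cls 0) = cls 0) (a : CoxVertex d) :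
    height (e a) ≤ height a := by
  obtain ⟨f, hf, rfl⟩ := exists_normalized a
  have hs := height_cls hf
  generalize height (cls f) = n at hs ⊢
  induction n generalizing f with
  | zero =>
    have h0 : f = 0 := by
      ext i
      exact (Finset.sum_eq_zero_iff_of_nonneg (fun i _ => hf.1 i)).1
        (by simpa using hs.symm) i (Finset.mem_univ i)
    rw [h0, he0]
    have := height_cls hf
    rw [h0] at this
    simp at this
    omega
  | succ n ih =>
    obtain ⟨i, hi⟩ : ∃ i, 0 < f i := by
      by_contra! hcon
      have : ∑ i, f i ≤ 0 := Finset.sum_nonpos fun i _ => hcon i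
      omega
    have hn : Normalized (f - Pi.single i 1) := by
      obtain ⟨h1, j, hj⟩ := hf
      refine ⟨fun k => ?_, j, ?_⟩
      · rw [Pi.sub_apply, Pi.single_apply]
        have := h1 k
        split_ifs with h
        · subst h; omega
        · omega
      · have : j ≠ i := by rintro rfl; omega
        simp [this, hj]
    have h := ih (f - Pi.single i 1) hn (by
      simp only [Pi.sub_apply, Finset.sum_sub_distrib, Finset.sum_pi_single', Finset.mem_univ,
        if_true]
      push_cast at hs
      omega)
    rcases Nat.eq_zero_or_pos d with rfl | hd
    · exfalso
      obtain ⟨-, j, hj⟩ := hf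
      rw [Subsingleton.elim (α := Fin 1) i j] at hi
      omega
    -- The classes of `f - e_i` and `f` are the first two vertices of a pointed chamber. Its image
    -- is again a pointed chamber, so the image of the second arises from that of the first by
    -- raising one coordinate.
    have hc := he _ (stdPointed_chamberList (f - Pi.single i 1) (Equiv.swap i 0))
    obtain ⟨k, τ, hk⟩ := hc.exists_chamberList (by simp [chamberList])
    have hval : ∀ t ≤ d, e (cls (chamber (f - Pi.single i 1) (Equiv.swap i 0) t)) =
        cls (chamber k τ t) := by
      intro t ht
      have := congrArg (fun l => l[t]?) hk
      simpa [chamberList, List.getElem?_range, Nat.lt_succ_iff, ht] using this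
    have h0 := hval 0 (by omega)
    have h1 := hval 1 hd
    rw [chamber_swap_one, sub_add_cancel] at h1
    rw [chamber_zero, chamber_zero] at h0
    have hk1 : chamber k τ 1 = k + Pi.single (τ.symm 0) 1 := by
      ext j
      have : (τ j : ℕ) < 1 ↔ j = τ.symm 0 := by
        rw [Nat.lt_one_iff, Fin.val_eq_zero_iff, Equiv.eq_symm_apply]
      simp [chamber, ind, mem_initialSet, this, Pi.single_apply]
    have := height_cls_add_single_le k (τ.symm 0)
    rw [h1, hk1]
    rw [h0] at h
    omega

end TildeA

namespace TildeA
universe u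
variable {d : ℕ} {V : Type u}

/-! ### Charts and retractions -/

theorem exists_map_eq_of_forall_mem_range {α β : Type*} {f : α → β} {l : List β}
    (h : ∀ v ∈ l, v ∈ Set.range f) : ∃ l' : List α, l'.map f = l := by
  have : l ∈ Set.range (List.map f) := by
    rw [Set.range_list_map]
    exact h
  exact this

theorem singleton_mem_of_mem {α : Type*} {K : PreAbstractSimplicialComplex α} {s : Finset α}
    (hs : s ∈ K) {v : α} (hv : v ∈ s) : {v} ∈ K :=
  (K.isRelLowerSet_faces hs).2 (Finset.singleton_subset_iff.2 hv) ⟨v, by simp⟩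

theorem singleton_mem_coxeterComplex (a : CoxVertex d) : {a} ∈ coxeterComplex d := by
  obtain ⟨f, rfl⟩ := cls_surjective a
  exact ⟨[cls f], stdPointed_map_cls (F := [f]) (by simp) (by simp), by simp⟩

/-- An identification of the Coxeter complex with an apartment which is compatible with the
orientation. -/
structure IsChart {X : Building d V} (o : Orientation X) (χ : CoxVertex d → V) : Prop where
  exists_apartment : ∃ A ∈ X.apartments, ∀ v, v ∈ Set.range χ ↔ {v} ∈ A
  injective : Function.Injective χ
  pointed_iff : ∀ l, o.Pointed (l.map χ) ↔ StdPointed l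

variable {X : Building d V} {o : Orientation X}

theorem exists_isChart (o : Orientation X) {A : PreAbstractSimplicialComplex V}
    (hA : A ∈ X.apartments) :
    ∃ χ, IsChart o χ ∧ (∀ v, v ∈ Set.range χ ↔ {v} ∈ A) ∧
      ∀ s : Finset V, s ∈ A ↔ ∃ l, StdPointed l ∧ ∀ v, v ∈ s ↔ v ∈ l.map χ := by
  classical
  obtain ⟨φ, hφ⟩ := o.apartment A hA
  set χ : CoxVertex d → V := fun a =>
    (φ.toEquiv.symm ⟨a, singleton_mem_coxeterComplex a⟩).1 with hχ
  have hr : ∀ v, v ∈ Set.range χ ↔ {v} ∈ A := by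
    intro v
    constructor
    · rintro ⟨a, rfl⟩
      exact (φ.toEquiv.symm _).2
    · intro h
      exact ⟨(φ.toEquiv ⟨v, h⟩).1, by simp [hχ]⟩
  refine ⟨χ, ⟨⟨A, hA, hr⟩, fun a b hab => ?_, fun l => ?_⟩, hr, fun s => ?_⟩
  · simpa [hχ, Subtype.ext_iff] using
      congrArg Subtype.val (φ.toEquiv.symm.injective (Subtype.val_injective hab))
  · have := hφ (l.map fun a => φ.toEquiv.symm ⟨a, singleton_mem_coxeterComplex a⟩)
    simpa [List.map_map, Function.comp_def] using this
  · by_cases hs : ∀ v ∈ s, {v} ∈ A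
    swap
    · refine ⟨fun h => absurd (fun v hv => singleton_mem_of_mem h hv) hs, ?_⟩
      rintro ⟨l, -, hl⟩
      refine absurd (fun v hv => (hr v).1 ?_) hs
      obtain ⟨a, -, rfl⟩ := List.mem_map.1 ((hl v).1 hv)
      exact ⟨a, rfl⟩
    set s' : Finset (Vert A) := s.subtype (fun v => {v} ∈ A) with hs'
    have h1 : s'.map (Function.Embedding.subtype _) = s := by
      rw [hs', Finset.subtype_map, Finset.filter_true_of_mem hs]
    have h2 := φ.mem_iff s'
    rw [h1] at h2
    rw [h2]
    refine exists_congr fun l => and_congr_right fun _ => ?_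
    constructor
    · intro h v
      by_cases hv : {v} ∈ A
      · have := h (φ.toEquiv ⟨v, hv⟩).1
        simp [hs'] at this
        have h3 : v ∈ l.map χ ↔ (φ.toEquiv ⟨v, hv⟩).1 ∈ l := by
          rw [List.mem_map]
          constructor
          · rintro ⟨a, ha, rfl⟩
            simpa [hχ] using ha
          · exact fun ha => ⟨_, ha, by simp [hχ]⟩
        rw [h3, ← this]
        exact ⟨fun h => ⟨(φ.toEquiv ⟨v, hv⟩).2, h⟩, fun h => h.2⟩
      · refine ⟨fun h => absurd (hs v h) hv, fun h => ?_⟩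
        obtain ⟨a, -, rfl⟩ := List.mem_map.1 h
        exact absurd ((hr _).1 ⟨a, rfl⟩) hv
    · intro h a
      have h3 := h (χ a)
      have hinj : Function.Injective χ := fun a b hab => by
        simpa [hχ, Subtype.ext_iff] using
          congrArg Subtype.val (φ.toEquiv.symm.injective (Subtype.val_injective hab))
      rw [List.mem_map_of_injective hinj] at h3
      rw [← h3]
      simp only [Finset.mem_map, hs', Finset.mem_subtype, Function.Embedding.coe_subtype]
      constructor
      · rintro ⟨-, ⟨v, hv, rfl⟩, rfl⟩
        simpa [hχ] using hv
      · intro ha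
        refine ⟨⟨a, singleton_mem_coxeterComplex a⟩,
          ⟨φ.toEquiv.symm ⟨a, singleton_mem_coxeterComplex a⟩, ha, by simp⟩, rfl⟩

/-- Apartments are full subcomplexes: pointedness of a tuple is a notion of the building, and the
chart of the apartment reflects it. -/
theorem mem_apartment_iff (o : Orientation X) {A : PreAbstractSimplicialComplex V}
    (hA : A ∈ X.apartments) {s : Finset V} :
    s ∈ A ↔ (∀ v ∈ s, {v} ∈ A) ∧ ∃ l, o.Pointed l ∧ ∀ v, v ∈ s ↔ v ∈ l := by
  obtain ⟨χ, hχ, hr, hm⟩ := exists_isChart o hA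
  constructor
  · intro h
    obtain ⟨l, hl, hls⟩ := (hm s).1 h
    exact ⟨fun v hv => singleton_mem_of_mem h hv, l.map χ, (hχ.pointed_iff l).2 hl, hls⟩
  · rintro ⟨h, l, hl, hls⟩
    obtain ⟨l', rfl⟩ := exists_map_eq_of_forall_mem_range (f := χ) (l := l) fun v hv =>
      (hr v).2 (h v ((hls v).2 hv))
    exact (hm s).2 ⟨l', (hχ.pointed_iff l').1 hl, hls⟩

theorem Orientation.exists_pointed (o : Orientation X) {s : Finset V} (hs : s ∈ X.complex) :
    ∃ l, o.Pointed l ∧ ∀ v, v ∈ s ↔ v ∈ l := by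
  obtain ⟨A, hA, h, -⟩ := X.exists_apartment s hs s hs
  exact ((mem_apartment_iff o hA).1 h).2

theorem Orientation.Pointed.exists_chart₂ {l₁ l₂ : List V} (h₁ : o.Pointed l₁)
    (h₂ : o.Pointed l₂) :
    ∃ χ, IsChart o χ ∧ (∃ l, StdPointed l ∧ l.map χ = l₁) ∧ ∃ l, StdPointed l ∧ l.map χ = l₂ := by
  obtain ⟨s, hs, hsl⟩ := o.simplex _ h₁
  obtain ⟨t, ht, htl⟩ := o.simplex _ h₂
  obtain ⟨A, hA, hsA, htA⟩ := X.exists_apartment s hs t ht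
  obtain ⟨χ, hχ, hr, -⟩ := exists_isChart o hA
  obtain ⟨l, rfl⟩ := exists_map_eq_of_forall_mem_range (f := χ) (l := l₁) fun v hv =>
    (hr v).2 (singleton_mem_of_mem hsA ((hsl v).2 hv))
  obtain ⟨l', rfl⟩ := exists_map_eq_of_forall_mem_range (f := χ) (l := l₂) fun v hv =>
    (hr v).2 (singleton_mem_of_mem htA ((htl v).2 hv))
  exact ⟨χ, hχ, ⟨l, (hχ.pointed_iff l).1 h₁, rfl⟩, l', (hχ.pointed_iff l').1 h₂, rfl⟩

theorem Orientation.Pointed.exists_chart {l : List V} (h : o.Pointed l) :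
    ∃ χ, IsChart o χ ∧ ∃ l', StdPointed l' ∧ l'.map χ = l := by
  obtain ⟨χ, h1, h2, -⟩ := h.exists_chart₂ h
  exact ⟨χ, h1, h2⟩

theorem Orientation.Pointed.nodup {l : List V} (h : o.Pointed l) : l.Nodup := by
  obtain ⟨χ, hχ, l, hl, rfl⟩ := h.exists_chart
  exact hl.nodup.map hχ.injective

theorem Orientation.Pointed.ne_nil {l : List V} (h : o.Pointed l) : l ≠ [] := by
  obtain ⟨χ, hχ, l, hl, rfl⟩ := h.exists_chart
  simpa using hl.ne_nil

theorem Orientation.Pointed.sublist {l l' : List V} (h : o.Pointed l) (hs : l'.Sublist l)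
    (hne : l' ≠ []) : o.Pointed l' := by
  obtain ⟨χ, hχ, l, hl, rfl⟩ := h.exists_chart
  obtain ⟨m, hm, rfl⟩ := List.sublist_map_iff.1 hs
  exact (hχ.pointed_iff m).2 (hl.sublist hm (by simpa using hne))

theorem Orientation.Pointed.rotate_one {v : V} {l : List V} (h : o.Pointed (v :: l)) :
    o.Pointed (l ++ [v]) := by
  obtain ⟨χ, hχ, l', hl, he⟩ := h.exists_chart
  obtain ⟨a, m, rfl, rfl, rfl⟩ := List.map_eq_cons_iff.1 he
  simpa using (hχ.pointed_iff (m ++ [a])).2 hl.rotate_one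

theorem Orientation.pointed_singleton (o : Orientation X) (v : V) : o.Pointed [v] := by
  obtain ⟨l, hl, hv⟩ := o.exists_pointed (X.complex.singleton_mem v)
  have : v ∈ l := (hv v).1 (by simp)
  exact hl.sublist (List.singleton_sublist.2 this) (by simp)

theorem IsChart.comp {χ : CoxVertex d → V} (hχ : IsChart o χ) {e : CoxVertex d → CoxVertex d}
    (he : Function.Bijective e) (he' : ∀ l, StdPointed (l.map e) ↔ StdPointed l) :
    IsChart o (χ ∘ e) := by
  obtain ⟨A, hA, hr⟩ := hχ.exists_apartment
  refine ⟨⟨A, hA, fun v => ?_⟩, hχ.injective.comp he.1, fun l => ?_⟩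
  · rw [he.2.range_comp, hr]
  · rw [← List.map_map, hχ.pointed_iff, he']

/-- For two vertices a cyclic ordering carries no information, as rotation exchanges them; so
pointed pairs just express adjacency. -/
theorem Orientation.Pointed.pair_of_mem {x y : V} {l : List V} (h : o.Pointed l) (hx : x ∈ l)
    (hy : y ∈ l) (hne : x ≠ y) : o.Pointed [x, y] := by
  obtain ⟨l₁, l₂, rfl⟩ := List.append_of_mem hx
  rcases List.mem_append.1 hy with hy | hy
  · have : o.Pointed [y, x] := h.sublist (l' := [y] ++ [x])
      ((List.singleton_sublist.2 hy).append (by simp)) (by simp)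
    exact this.rotate_one
  · rcases List.mem_cons.1 hy with rfl | hy
    · exact absurd rfl hne
    · refine h.sublist ?_ (by simp)
      exact List.Sublist.trans (List.Sublist.cons_cons x (List.singleton_sublist.2 hy))
        (List.sublist_append_right _ _)

/-- Two charts which agree on a chamber agree wherever both are defined. -/
theorem IsChart.eq_of_agree {χ χ' : CoxVertex d → V} (hχ : IsChart o χ) (hχ' : IsChart o χ')
    {f : Fin (d + 1) → ℤ} {σ : Equiv.Perm (Fin (d + 1))}
    (h : ∀ a ∈ chamberList f σ, χ a = χ' a) {a a' : CoxVertex d} (ha : χ a = χ' a') : a = a' := by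
  classical
  obtain ⟨A, hA, hr⟩ := hχ.exists_apartment
  obtain ⟨A', hA', hr'⟩ := hχ'.exists_apartment
  have hc := stdPointed_chamberList f σ
  obtain ⟨s, -, hs⟩ := o.simplex _ ((hχ.pointed_iff _).2 hc)
  have hsA : s ∈ A := (mem_apartment_iff o hA).2 ⟨fun v hv => by
    obtain ⟨b, -, rfl⟩ := List.mem_map.1 ((hs v).1 hv)
    exact (hr _).1 ⟨b, rfl⟩, _, (hχ.pointed_iff _).2 hc, hs⟩
  have hmap : (chamberList f σ).map χ = (chamberList f σ).map χ' := List.map_congr_left h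
  have hsA' : s ∈ A' := (mem_apartment_iff o hA').2 ⟨fun v hv => by
    have := (hs v).1 hv
    rw [hmap] at this
    obtain ⟨b, -, rfl⟩ := List.mem_map.1 this
    exact (hr' _).1 ⟨b, rfl⟩, _, (hχ.pointed_iff _).2 hc, hs⟩
  obtain ⟨φ, hφ⟩ := X.exists_iso A hA A' hA' s {χ a} hsA ((hr _).1 ⟨a, rfl⟩) hsA'
    (ha ▸ (hr' _).1 ⟨a', rfl⟩)
  -- `ψ` is the isomorphism of apartments read in the two charts. It fixes the given chamber, hence
  -- is the identity by `rigid`, while it also sends `a` to `a'`.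
  have hex : ∀ b, ∃ c, χ' c = (φ.toEquiv ⟨χ b, (hr _).1 ⟨b, rfl⟩⟩).1 := fun b =>
    (hr' _).2 (φ.toEquiv ⟨χ b, (hr _).1 ⟨b, rfl⟩⟩).2
  choose ψ hψ using hex
  have hψinj : Function.Injective ψ := by
    intro b c hbc
    have := hψ b
    rw [hbc, hψ c] at this
    have := φ.toEquiv.injective (Subtype.val_injective this)
    exact (hχ.injective (congrArg Subtype.val this)).symm
  -- The isomorphism need not respect the orientation, but adjacency is all that is required.
  have hadj : ∀ b c, StdPointed [b, c] → StdPointed [ψ b, ψ c] := by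
    intro b c hbc
    have hne : b ≠ c := by simpa using hbc.nodup
    have hp := (hχ.pointed_iff [b, c]).2 hbc
    set B : Vert A := ⟨χ b, (hr _).1 ⟨b, rfl⟩⟩ with hB
    set C : Vert A := ⟨χ c, (hr _).1 ⟨c, rfl⟩⟩ with hC
    have h1 := φ.mem_iff {B, C}
    simp only [Finset.map_insert, Finset.map_singleton, Function.Embedding.coe_subtype,
      Equiv.coe_toEmbedding] at h1
    rw [← hψ b, ← hψ c] at h1
    have h2 := h1.1 ((mem_apartment_iff o hA).2 ⟨fun v hv => by
      rcases Finset.mem_insert.1 hv with rfl | hv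
      · exact B.2
      · obtain rfl := Finset.mem_singleton.1 hv
        exact C.2, _, hp, by simp [hB, hC]⟩)
    obtain ⟨-, l, hl, hm⟩ := (mem_apartment_iff o hA').1 h2
    refine (hχ'.pointed_iff [ψ b, ψ c]).1 ?_
    exact hl.pair_of_mem ((hm _).1 (by simp)) ((hm _).1 (by simp))
      fun he => hne (hψinj (hχ'.injective he))
  have key := rigid hψinj hadj (f := f) (σ := σ) (fun b hb => hχ'.injective
    ((hψ b).trans ((hφ _ (.inl ((hs _).2 (List.mem_map_of_mem hb)))).trans (h b hb)))) a
  rw [← key]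
  exact hχ'.injective ((hψ a).trans ((hφ _ (.inr (by simp))).trans ha))

/-- A chamber of an apartment and a simplex lie in a common apartment, which can be identified
with the Coxeter complex in the same way on the chamber. -/
theorem IsChart.exists_agree {χ : CoxVertex d → V} (hχ : IsChart o χ) (f : Fin (d + 1) → ℤ)
    (σ : Equiv.Perm (Fin (d + 1))) {l : List V} (hl : o.Pointed l) :
    ∃ ε, IsChart o ε ∧ (∀ a ∈ chamberList f σ, ε a = χ a) ∧
      ∃ l', StdPointed l' ∧ l'.map ε = l := by
  obtain ⟨ε, hε, ⟨c, hc, hcm⟩, l', hl', rfl⟩ :=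
    ((hχ.pointed_iff _).2 (stdPointed_chamberList f σ)).exists_chart₂ hl
  have hlen := congrArg List.length hcm
  simp only [List.length_map] at hlen
  obtain ⟨f', σ', rfl⟩ := hc.exists_chamberList (by rw [hlen]; simp [chamberList])
  obtain ⟨e, he, he', hec⟩ := exists_automorphism_chamberList f f' σ σ'
  refine ⟨ε ∘ e, hε.comp he he', ?_, ?_⟩
  · rw [← hec, List.map_map] at hcm
    exact List.map_inj_left.1 hcm
  · obtain ⟨m, rfl⟩ := exists_map_eq_of_forall_mem_range (f := e) (l := l') fun v _ => he.2 v
    refine ⟨m, (he' m).1 hl', by simp⟩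

/-- The retraction onto an apartment centred at a chamber. -/
theorem IsChart.exists_retraction {χ : CoxVertex d → V} (hχ : IsChart o χ) (f : Fin (d + 1) → ℤ)
    (σ : Equiv.Perm (Fin (d + 1))) : ∃ ρ : V → CoxVertex d, (∀ a, ρ (χ a) = a) ∧
      ∀ l, o.Pointed l → ∃ ε, IsChart o ε ∧ (∀ a ∈ chamberList f σ, ε a = χ a) ∧
        (∀ a, ρ (ε a) = a) ∧ ∃ l', StdPointed l' ∧ l'.map ε = l := by
  -- The coordinate of `v` does not depend on the chart, by `IsChart.eq_of_agree`; this makes the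
  -- retraction well defined.
  have hex : ∀ v, ∃ a, ∀ ε, IsChart o ε → (∀ a ∈ chamberList f σ, ε a = χ a) →
      ∀ b, ε b = v → b = a := by
    intro v
    obtain ⟨ε, hε, hag, l', -, hl'⟩ := hχ.exists_agree f σ (o.pointed_singleton v)
    obtain ⟨a, m, rfl, rfl, -⟩ := List.map_eq_cons_iff.1 hl'
    refine ⟨a, fun ε' hε' hag' b hb => ?_⟩
    exact hε'.eq_of_agree hε (fun c hc => (hag' c hc).trans (hag c hc).symm) hb
  choose ρ hρ using hex
  have hρ' : ∀ ε, IsChart o ε → (∀ a ∈ chamberList f σ, ε a = χ a) → ∀ a, ρ (ε a) = a :=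
    fun ε hε hag a => (hρ _ ε hε hag a rfl).symm
  refine ⟨ρ, hρ' χ hχ fun _ _ => rfl, fun l hl => ?_⟩
  obtain ⟨ε, hε, hag, hl'⟩ := hχ.exists_agree f σ hl
  exact ⟨ε, hε, hag, hρ' ε hε hag, hl'⟩

end TildeA

namespace TildeA
universe u
variable {d : ℕ} {V : Type u} {X : Building d V} {o : Orientation X}

/-! ### Meets -/

/-- Lift `a`, `b`, `c` to `r < g < y < r + 1`. The lift of `m` lies between `g` and `y`, hence in
the window above `r`. Thus relations only have to be checked against the last vertex. -/
theorem StdPointed.glue {a b c : CoxVertex d} {m : List (CoxVertex d)} (h : StdPointed [a, b, c])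
    (h' : StdPointed (b :: (m ++ [c]))) : StdPointed (a :: b :: (m ++ [c])) := by
  obtain ⟨g, rfl⟩ := cls_surjective b
  obtain ⟨G, hG, hm⟩ := h'.exists_lift_cons
  obtain ⟨M, K, rfl, rfl, hK⟩ := List.map_eq_append_iff.1 hm
  obtain ⟨y, K', rfl, rfl, hK'⟩ := List.map_eq_cons_iff.1 hK
  obtain rfl := List.map_eq_nil_iff.1 hK'
  have hgy : Window g y := (List.pairwise_cons.1 hG).1 y (by simp)
  obtain ⟨R, hR, hl⟩ := StdPointed.exists_lift_append (l := [a]) (H := [g, y]) (by simpa using hgy)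
    (by simp) h
  obtain ⟨r, R', rfl, rfl, hR'⟩ := List.map_eq_cons_iff.1 hl
  obtain rfl := List.map_eq_nil_iff.1 hR'
  simp only [List.singleton_append, List.pairwise_cons, List.mem_cons, List.not_mem_nil, or_false,
    forall_eq_or_imp, forall_eq] at hR
  have hM := (List.pairwise_append.1 (List.pairwise_cons.1 hG).2).2.2
  have : (r :: g :: (M ++ [y])).Pairwise Window := by
    refine List.pairwise_cons.2 ⟨fun z hz => ?_, hG⟩
    rcases List.mem_cons.1 hz with rfl | hz
    · exact hR.1.1
    rcases List.mem_append.1 hz with hz | hz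
    · exact ⟨hR.1.1.1.trans ((List.pairwise_cons.1 hG).1 z (by simp [hz])).1,
        (hM z hz y (by simp)).1.trans hR.1.2.2⟩
    · obtain rfl := List.mem_singleton.1 hz
      exact hR.1.2
  simpa using stdPointed_map_cls this (by simp)

theorem Orientation.Pointed.glue {w v x : V} {m : List V} (h : o.Pointed [w, v, x])
    (h' : o.Pointed (v :: (m ++ [x]))) : o.Pointed (w :: v :: (m ++ [x])) := by
  obtain ⟨χ, hχ, ⟨l, hl, hlm⟩, l', hl', hlm'⟩ := h.exists_chart₂ h'
  obtain ⟨b, K, rfl, rfl, hK⟩ := List.map_eq_cons_iff.1 hlm'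
  obtain ⟨M, N, rfl, rfl, hN⟩ := List.map_eq_append_iff.1 hK
  obtain ⟨c, N', rfl, rfl, hN'⟩ := List.map_eq_cons_iff.1 hN
  obtain rfl := List.map_eq_nil_iff.1 hN'
  obtain ⟨a, L, rfl, rfl, hL⟩ := List.map_eq_cons_iff.1 hlm
  have : L = [b, c] := List.map_injective_iff.2 hχ.injective (by simpa using hL)
  subst this
  simpa using (hχ.pointed_iff _).2 (hl.glue hl')

/-- Coordinate sums are distinct along a lift and lie in an interval of `d + 1` integers. The bound
ensures that the supremum defining `len` is attained. -/
theorem StdPointed.length_le {l : List (CoxVertex d)} (h : StdPointed l) : l.length ≤ d + 1 := by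
  obtain ⟨a, l, rfl⟩ := List.exists_cons_of_ne_nil h.ne_nil
  obtain ⟨f, rfl⟩ := cls_surjective a
  obtain ⟨G, hG, rfl⟩ := h.exists_lift_cons
  set L := (f :: G).map fun g => ∑ i, g i with hL
  have hnd : L.Nodup := by
    rw [hL, List.Nodup, List.pairwise_map]
    exact hG.imp fun h => (sum_lt_sum_of_lt h.1).ne
  have hsub : L.toFinset ⊆ Finset.Ico (∑ i, f i) (∑ i, f i + (d + 1 : ℕ)) := by
    intro c hc
    rw [List.mem_toFinset, hL, List.mem_map] at hc
    obtain ⟨g, hg, rfl⟩ := hc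
    rw [Finset.mem_Ico]
    rcases List.mem_cons.1 hg with rfl | hg
    · constructor
      · exact le_rfl
      · push_cast
        omega
    · have hw := (List.pairwise_cons.1 hG).1 g hg
      have h1 := sum_lt_sum_of_lt hw.1
      have h2 := sum_lt_sum_of_lt hw.2
      simp only [Pi.add_apply, Pi.one_apply, Finset.sum_add_distrib, Finset.sum_const,
        Finset.card_univ, Fintype.card_fin, nsmul_eq_mul, mul_one] at h2
      exact ⟨h1.le, h2⟩
  have := Finset.card_le_card hsub
  rw [List.toFinset_card_of_nodup hnd, Int.card_Ico] at this
  simpa [hL] using this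

theorem Orientation.Pointed.length_le {l : List V} (h : o.Pointed l) : l.length ≤ d + 1 := by
  obtain ⟨χ, -, l', hl', rfl⟩ := h.exists_chart
  simpa using hl'.length_le

/-- A longest pointed simplex from `v` to `x` can be prolonged by `w` in front, by `glue`. So going
down in N_η̂ increases `len`, and a lower bound of least `len` is a candidate for the greatest one.
-/
theorem Orientation.len_lt_len {w v x : V} {m : List V}
    (h : o.Pointed (w :: v :: (m ++ [x]))) :
    o.len (v :: (m ++ [x])) < o.len (w :: (m ++ [x])) := by
  have hbdd : ∀ l : List V, BddAbove {r | ∃ l', o.Pointed l' ∧ l'.length = r + 1 ∧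
      l'.head? = l.head? ∧ l'.getLast? = l.getLast?} := by
    rintro l
    refine ⟨d, ?_⟩
    rintro r ⟨l', hl', hr, -⟩
    have := hl'.length_le
    omega
  have hcons : ∀ (k : V) (m : List V) (x : V), (k :: (m ++ [x])).getLast? = some x :=
    fun k m x => by rw [← List.cons_append, List.getLast?_concat]
  have hv : o.Pointed (v :: (m ++ [x])) := h.sublist (List.sublist_cons_self _ _) (by simp)
  obtain ⟨l', hl', hr, hh, hlast⟩ := Nat.sSup_mem
    (s := {r | ∃ l', o.Pointed l' ∧ l'.length = r + 1 ∧
      l'.head? = (v :: (m ++ [x])).head? ∧ l'.getLast? = (v :: (m ++ [x])).getLast?})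
    ⟨(m ++ [x]).length, _, hv, rfl, rfl, rfl⟩ (hbdd _)
  refine Nat.lt_of_succ_le (le_csSup (hbdd _) ⟨w :: l', ?_, ?_, by simp, ?_⟩)
  · obtain ⟨k, l'', rfl⟩ := List.exists_cons_of_ne_nil hl'.ne_nil
    simp only [List.head?_cons, Option.some.injEq] at hh
    subst hh
    have hkx : k ≠ x := by
      rintro rfl
      simpa using hv.nodup
    rcases List.eq_nil_or_concat l'' with rfl | ⟨m', y, rfl⟩
    · rw [hcons] at hlast
      exact absurd (by simpa using hlast) hkx
    · simp only [List.concat_eq_append] at hlast hl' ⊢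
      have : y = x := by
        rw [hcons, hcons] at hlast
        simpa using hlast
      subst this
      refine Orientation.Pointed.glue (h.sublist ?_ (by simp)) hl'
      simp
  · simpa [Orientation.len] using hr
  · obtain ⟨k, l'', rfl⟩ := List.exists_cons_of_ne_nil hl'.ne_nil
    rw [List.getLast?_cons_cons, hlast, hcons, hcons]

theorem IsChart.le_iff {χ : CoxVertex d → V} (hχ : IsChart o χ) {H : List (Fin (d + 1) → ℤ)}
    (hne : H ≠ []) {g g' : Fin (d + 1) → ℤ} (hg : (g :: H).Pairwise Window)
    (hg' : (g' :: H).Pairwise Window) :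
    o.Le ((H.map cls).map χ) (χ (cls g)) (χ (cls g')) ↔ g ≤ g' := by
  rw [le_iff_stdPointed hne hg hg', ← hχ.pointed_iff]
  simp only [Orientation.Le, List.map_cons, hχ.injective.eq_iff]

theorem Orientation.Le.exists_pointed {η : List V} {w v : V} (h : o.Le η w v)
    (hw : w ∈ o.nbhd η) : ∃ l, o.Pointed (l ++ η) ∧ w ∈ l ∧ v ∈ l := by
  rcases h with rfl | h
  · exact ⟨[w], hw, by simp, by simp⟩
  · exact ⟨[w, v], h, by simp, by simp⟩

/-- Lower bounds have a greatest element, which is the meet. -/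
theorem Orientation.exists_isMeet (o : Orientation X) {m : List V} {x u₁ u₂ : V}
    (h₁ : u₁ ∈ o.nbhd (m ++ [x])) (h₂ : u₂ ∈ o.nbhd (m ++ [x]))
    (hne : (o.lowerBounds (m ++ [x]) u₁ u₂).Nonempty) :
    ∃ v, o.IsMeet (m ++ [x]) u₁ u₂ v ∧
      ∀ w ∈ o.lowerBounds (m ++ [x]) u₁ u₂, o.Le (m ++ [x]) w v := by
  obtain ⟨v, hv, hmin⟩ := WellFounded.has_min (measure fun v => o.len (v :: (m ++ [x]))).wf _ hne
  have key : ∀ w ∈ o.lowerBounds (m ++ [x]) u₁ u₂, o.Le (m ++ [x]) w v := by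
    rintro w hw
    obtain ⟨l₁, hl₁, hw₁, hu₁⟩ := hw.2.1.exists_pointed hw.1
    obtain ⟨l₂, hl₂, hv₂, hu₂⟩ := hv.2.2.exists_pointed hv.1
    -- One apartment contains `w`, `u₁`, `v`, `u₂` and η, because the pairs `w`, `u₁` and `v`, `u₂`
    -- each lie in a simplex together with η.
    obtain ⟨χ, hχ, ⟨k₁, hk₁, hm₁⟩, k₂, hk₂, hm₂⟩ := hl₁.exists_chart₂ hl₂
    obtain ⟨l₁, c, rfl, rfl, hc⟩ := List.map_eq_append_iff.1 hm₁
    obtain ⟨l₂, c', rfl, rfl, hc'⟩ := List.map_eq_append_iff.1 hm₂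
    have hcne : c ≠ [] := by
      rintro rfl
      simp at hc
    obtain ⟨-, H, hH, rfl⟩ := stdPointed_iff.1
      (hk₁.sublist (List.sublist_append_right _ _) hcne)
    have hHne : H ≠ [] := by simpa using hcne
    have hlift : ∀ z ∈ o.nbhd (m ++ [x]), z ∈ Set.range χ →
        ∃ g, (g :: H).Pairwise Window ∧ χ (cls g) = z := by
      rintro z hz ⟨a, rfl⟩
      have h : o.Pointed ((a :: H.map cls).map χ) := by
        rw [List.map_cons, hc]
        exact hz
      obtain ⟨G, hG, hGa⟩ := StdPointed.exists_lift_append (l := [a]) hH hHne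
        ((hχ.pointed_iff _).1 h)
      obtain ⟨g, G', rfl, rfl, hG'⟩ := List.map_eq_cons_iff.1 hGa
      obtain rfl := List.map_eq_nil_iff.1 hG'
      exact ⟨g, hG, rfl⟩
    have hrange : ∀ {l : List (CoxVertex d)} {z}, z ∈ l.map χ → z ∈ Set.range χ := fun {l z} h => by
      obtain ⟨a, -, rfl⟩ := List.mem_map.1 h
      exact ⟨a, rfl⟩
    obtain ⟨gw, hgw, rfl⟩ := hlift w hw.1 (hrange hw₁)
    obtain ⟨gv, hgv, rfl⟩ := hlift v hv.1 (hrange hv₂)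
    obtain ⟨g₁, hg₁, rfl⟩ := hlift u₁ h₁ (hrange hu₁)
    obtain ⟨g₂, hg₂, rfl⟩ := hlift u₂ h₂ (hrange hu₂)
    rw [← hc] at hw hv hmin ⊢
    have hw1 := (hχ.le_iff hHne hgw hg₁).1 hw.2.1
    have hw2 := (hχ.le_iff hHne hgw hg₂).1 hw.2.2
    have hv1 := (hχ.le_iff hHne hgv hg₁).1 hv.2.1
    have hv2 := (hχ.le_iff hHne hgv hg₂).1 hv.2.2
    -- The minimum stays in the window: it is below `H` because `g₁` is, and high enough because it
    -- dominates the lift of the lower bound `w`.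
    have hg : ((g₁ ⊓ g₂) :: H).Pairwise Window := by
      refine List.pairwise_cons.2 ⟨fun y hy => ⟨?_, ?_⟩, hH⟩
      · exact inf_le_left.trans_lt ((List.pairwise_cons.1 hg₁).1 y hy).1
      · refine ((List.pairwise_cons.1 hgw).1 y hy).2.trans_le ?_
        exact add_le_add_left (le_inf hw1 hw2) 1
    have hmem : χ (cls (g₁ ⊓ g₂)) ∈
        o.lowerBounds ((H.map cls).map χ) (χ (cls g₁)) (χ (cls g₂)) := by
      refine ⟨?_, (hχ.le_iff hHne hg hg₁).2 inf_le_left, (hχ.le_iff hHne hg hg₂).2 inf_le_right⟩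
      exact (hχ.pointed_iff (cls (g₁ ⊓ g₂) :: H.map cls)).2 (stdPointed_map_cls hg (by simp))
    refine (hχ.le_iff hHne hgw hgv).2 ((le_inf hw1 hw2).trans ?_)
    -- If `v` were strictly below the minimum, the minimum would be a lower bound of smaller `len`.
    rcases (hχ.le_iff hHne hgv hg).2 (le_inf hv1 hv2) with h | h
    · have := (hχ.le_iff hHne hg hgv).1 (.inl h.symm)
      exact this
    · refine absurd ?_ (hmin _ hmem)
      rw [hc] at h ⊢
      exact Orientation.len_lt_len h
  refine ⟨v, ⟨hv, fun w hw hwv => ?_⟩, key⟩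
  rcases key w hw with h | h
  · exact absurd h hwv
  · exact Orientation.len_lt_len h

/-! ### The distance from a base vertex -/

/-- `h` is the distance from the base vertex `z`: in suitable apartments containing `z` and a
given simplex it is the height. -/
def IsHeight (o : Orientation X) (z : V) (h : V → ℕ) : Prop :=
  ∀ l, o.Pointed l → ∃ χ, IsChart o χ ∧ χ (cls 0) = z ∧ (∀ a, h (χ a) = height a) ∧
    ∃ l', StdPointed l' ∧ l'.map χ = l

theorem exists_isHeight (o : Orientation X) : ∃ z h, IsHeight o z h := by
  obtain ⟨v⟩ := X.nonempty
  obtain ⟨χ, hχ, -⟩ := (o.pointed_singleton v).exists_chart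
  obtain ⟨ρ, -, hρ⟩ := hχ.exists_retraction 0 1
  refine ⟨χ (cls 0), fun v => height (ρ v), fun l hl => ?_⟩
  obtain ⟨ε, hε, hag, hρε, hl'⟩ := hρ l hl
  exact ⟨ε, hε, hag _ (mem_chamberList.2 ⟨0, by omega, by rw [chamber_zero]⟩),
    fun a => congrArg height (hρε a), hl'⟩

variable {z : V} {h : V → ℕ}

/-- Composed with a chart that sends `0` to `z` and computes `h`, the map `ρ` preserves pointed
simplices and fixes `0`, so `height_map_le` applies. -/
theorem IsHeight.height_le (hh : IsHeight o z h) {ρ : V → CoxVertex d}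
    (hρ : ∀ l, o.Pointed l → StdPointed (l.map ρ)) (hz : ρ z = cls 0) (q : V) :
    height (ρ q) ≤ h q := by
  obtain ⟨χ, hχ, hχz, hχh, l, hl, hlq⟩ := hh [q] (o.pointed_singleton q)
  obtain ⟨a, -, rfl, rfl, -⟩ := List.map_eq_cons_iff.1 hlq
  rw [hχh]
  refine height_map_le (e := ρ ∘ χ) (fun l hl => ?_) (by simp [hχz, hz]) a
  rw [← List.map_map]
  exact hρ _ ((hχ.pointed_iff l).2 hl)

/-- The projection of the base vertex to the link of `x`. -/
theorem IsHeight.exists_projection (hh : IsHeight o z h) (x : V) (hx : h x ≠ 0) :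
    ∃ p, o.Pointed [p, x] ∧ h p < h x ∧
      ∀ q, o.Pointed [q, x] → h q < h x → p = q ∨ o.Pointed [p, q, x] := by
  obtain ⟨χ, hχ, hχz, hχh, l, hl, hlq⟩ := hh [x] (o.pointed_singleton x)
  obtain ⟨a, -, rfl, rfl, -⟩ := List.map_eq_cons_iff.1 hlq
  rw [hχh] at hx
  obtain ⟨p, hpa, hpa', ⟨f, σ, hpc, hac⟩, hp⟩ := TildeA.exists_projection a hx
  refine ⟨χ p, (hχ.pointed_iff [p, a]).2 hpa, by rwa [hχh, hχh], fun q hq hqx => ?_⟩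
  -- Retract from a chamber containing `p` and `x`. The image of `q` is still a neighbour of `x`
  -- nearer to `z`, so `p` precedes it in the apartment; a chart agreeing on the chamber and
  -- covering `q` carries this back.
  obtain ⟨ρ, hρχ, hρ⟩ := hχ.exists_retraction f σ
  have hρ' : ∀ l, o.Pointed l → StdPointed (l.map ρ) := by
    intro l hl
    obtain ⟨ε, -, -, hρε, l', hl', rfl⟩ := hρ l hl
    rw [List.map_map, show ρ ∘ ε = id from funext hρε, List.map_id]
    exact hl'
  have hle := hh.height_le hρ' (by rw [← hχz, hρχ]) q
  obtain ⟨ε, hε, hag, hρε, l', hl', hlq'⟩ := hρ _ hq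
  obtain ⟨b, L, rfl, rfl, hL⟩ := List.map_eq_cons_iff.1 hlq'
  obtain ⟨c, L', rfl, hca, hL'⟩ := List.map_eq_cons_iff.1 hL
  obtain rfl := List.map_eq_nil_iff.1 hL'
  have hca : c = a := hε.injective (hca.trans (hag a hac).symm)
  subst hca
  rw [hρε] at hle
  rw [hχh] at hqx
  rw [← hag p hpc, ← hag c hac]
  rcases hp b hl' (hle.trans_lt hqx) with h | h
  · exact .inl (by rw [h])
  · exact .inr ((hε.pointed_iff [p, b, c]).2 h)

theorem IsHeight.between (hh : IsHeight o z h) {u v w : V} (huvw : o.Pointed [u, v, w])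
    (huw : h u < h w) : h u < h v ∧ h v < h w := by
  obtain ⟨χ, hχ, -, hχh, l, hl, hlq⟩ := hh _ huvw
  obtain ⟨a, L, rfl, rfl, hL⟩ := List.map_eq_cons_iff.1 hlq
  obtain ⟨b, L', rfl, rfl, hL'⟩ := List.map_eq_cons_iff.1 hL
  obtain ⟨c, L'', rfl, rfl, hL''⟩ := List.map_eq_cons_iff.1 hL'
  obtain rfl := List.map_eq_nil_iff.1 hL''
  simp only [hχh] at huw ⊢
  exact hl.height_between huw

theorem IsHeight.exists_sorted (hh : IsHeight o z h) {s : Finset V} (hs : s ∈ X.complex) :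
    ∃ l, o.Pointed l ∧ (∀ v, v ∈ s ↔ v ∈ l) ∧ l.Pairwise (h · < h ·) := by
  obtain ⟨l, hl, hls⟩ := o.exists_pointed hs
  obtain ⟨χ, hχ, -, hχh, l', hl', rfl⟩ := hh l hl
  obtain ⟨k, hk, hkm, hkh⟩ := hl'.exists_sorted
  refine ⟨k.map χ, (hχ.pointed_iff k).2 hk, fun v => ?_, ?_⟩
  · rw [hls, List.mem_map, List.mem_map]
    simp only [hkm]
  · rw [List.pairwise_map]
    simpa only [hχh] using hkh

/-- The neighbours of a simplex, in the direction of the base vertex, which are closer to the base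
vertex than the simplex form a stable set. -/
theorem IsHeight.stable (hh : IsHeight o z h) {η : List V} (hη : η.Pairwise (h · < h ·))
    (hne : η ≠ []) : o.Stable η {v | v ∈ o.nbhd η ∧ ∀ y ∈ η, h v < h y} := by
  refine ⟨fun v hv => hv.1, ?_⟩
  rintro u₁ ⟨h₁, h₁'⟩ u₂ ⟨h₂, h₂'⟩
  rcases List.eq_nil_or_concat η with rfl | ⟨m, x, rfl⟩
  · exact absurd rfl hne
  rw [List.concat_eq_append] at *
  have hpair : ∀ v ∈ o.nbhd (m ++ [x]), o.Pointed [v, x] := fun v hv =>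
    Orientation.Pointed.sublist hv (by simp) (by simp)
  have hux := h₁' x (by simp)
  obtain ⟨p, hpx, hpx', hp⟩ := hh.exists_projection x (by omega)
  -- The projection of `z` to the last vertex `x` bounds from below every member of the set, so all
  -- meets are defined.
  have hple : ∀ v ∈ o.nbhd (m ++ [x]), h v < h x → o.Le (m ++ [x]) p v := by
    intro v hv hvx
    rcases hp v (hpair v hv) hvx with rfl | hpv
    · exact .inl rfl
    · exact .inr (hpv.glue hv)
  have hpn : p ∈ o.nbhd (m ++ [x]) := by
    rcases hple u₁ h₁ hux with rfl | hpu
    · exact h₁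
    · exact hpu.sublist (by simp) (by simp)
  have hpW : p ∈ o.lowerBounds (m ++ [x]) u₁ u₂ :=
    ⟨hpn, hple u₁ h₁ hux, hple u₂ h₂ (h₂' x (by simp))⟩
  obtain ⟨v, hv, hmax⟩ := o.exists_isMeet h₁ h₂ ⟨p, hpW⟩
  refine ⟨v, ⟨hv.1.1, fun y hy => ?_⟩, hv⟩
  have hpy : h p < h y := by
    rcases hple u₁ h₁ hux with rfl | hpu
    · exact h₁' y hy
    · refine (hh.between (v := u₁) (w := x) (hpu.sublist (by simp) (by simp)) hpx').1.trans
        (h₁' y hy)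
  -- Either the meet is `p`, or `p`, `v`, `y` is a pointed triple with `p` lower than `y`, which
  -- forces `v` to be lower than `y`.
  rcases hmax p hpW with rfl | hpv
  · exact hpy
  · refine (hh.between (hpv.sublist ?_ (by simp)) hpy).2
    exact ((List.singleton_sublist.2 hy).cons_cons v).cons_cons p

end TildeA

namespace TildeA
universe u w
variable {d : ℕ} {V : Type u} {X : Building d V}

/-! ### The chain complex -/

section Homology

open Classical

/-- Removing the vertex of smaller label moves the other one down by one place, while removing the
larger one changes nothing for the smaller; the two products have opposite signs. -/
theorem Labelling.incidence_mul_add (lab : Labelling X) {σ : Finset V} (hσ : σ ∈ X.complex)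
    {v w : V} (hv : v ∈ σ) (hw : w ∈ σ) (hvw : v ≠ w) :
    lab.incidence σ v * lab.incidence (σ.erase v) w +
      lab.incidence σ w * lab.incidence (σ.erase w) v = 0 := by
  wlog h : lab.label v < lab.label w generalizing v w
  · have hne : lab.label v ≠ lab.label w := fun he => hvw (lab.injOn σ hσ hv hw he)
    have := this hw hv hvw.symm (lt_of_le_of_ne (not_lt.1 h) hne.symm)
    linarith
  have h1 : (σ.erase w).filter (fun x => lab.label x < lab.label v) =
      σ.filter fun x => lab.label x < lab.label v := by
    rw [Finset.filter_erase]
    refine Finset.erase_eq_of_notMem ?_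
    simp [h.le]
  have h2 : ((σ.erase v).filter fun x => lab.label x < lab.label w).card + 1 =
      (σ.filter fun x => lab.label x < lab.label w).card := by
    rw [Finset.filter_erase]
    exact Finset.card_erase_add_one (by simp [hv, h])
  unfold Labelling.incidence
  rw [h1, ← h2, pow_succ]
  ring

namespace HomCoeffSystem

variable (𝒱 : HomCoeffSystem.{u, w} X) (lab : Labelling X)

/-- The group of all chains, of all dimensions. -/
abbrev TotalChains : Type _ := DirectSum {σ : Finset V // σ ∈ X.complex} 𝒱.obj

/-- The image in `𝒱(A)` of an element of `𝒱(σ)`, as a chain; it is `0` if `A` is not a face. -/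
noncomputable def face {σ : {σ : Finset V // σ ∈ X.complex}} (x : 𝒱.obj σ) (A : Finset V) :
    𝒱.TotalChains :=
  if h : A ∈ X.complex ∧ A ⊆ σ.1 then
    DirectSum.of 𝒱.obj ⟨A, h.1⟩ (𝒱.map (σ := ⟨A, h.1⟩) h.2 x) else 0

/-- The differential on all chains. -/
noncomputable def totalBoundary : 𝒱.TotalChains →+ 𝒱.TotalChains :=
  DirectSum.toAddMonoid fun σ =>
    ∑ v ∈ σ.1,
      if h : σ.1.erase v ∈ X.complex then
        lab.incidence σ.1 v •
          (DirectSum.of 𝒱.obj ⟨σ.1.erase v, h⟩).comp (𝒱.map (σ.1.erase_subset v))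
      else 0

/-- Extension of chains by zero. -/
noncomputable def extend (S : Set (Finset V)) : 𝒱.Chains S →+ 𝒱.TotalChains :=
  DirectSum.toAddMonoid fun σ => DirectSum.of 𝒱.obj σ.1

/-- Restriction of chains. -/
noncomputable def restrict (S : Set (Finset V)) : 𝒱.TotalChains →+ 𝒱.Chains S :=
  DirectSum.toAddMonoid fun σ =>
    if h : σ.1 ∈ S then
      DirectSum.of (fun τ : {τ : {τ : Finset V // τ ∈ X.complex} // τ.1 ∈ S} => 𝒱.obj τ.1) ⟨σ, h⟩
    else 0

variable {𝒱 lab}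

theorem totalBoundary_of {σ : {σ : Finset V // σ ∈ X.complex}} (x : 𝒱.obj σ) :
    𝒱.totalBoundary lab (DirectSum.of 𝒱.obj σ x) =
      ∑ v ∈ σ.1, lab.incidence σ.1 v • 𝒱.face x (σ.1.erase v) := by
  unfold totalBoundary
  rw [DirectSum.toAddMonoid_of, AddMonoidHom.finsetSum_apply]
  refine Finset.sum_congr rfl fun v _ => ?_
  unfold face
  by_cases h : σ.1.erase v ∈ X.complex
  · simp [h, Finset.erase_subset]
  · simp [h]

theorem totalBoundary_face {σ : {σ : Finset V // σ ∈ X.complex}} (x : 𝒱.obj σ) {A : Finset V}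
    (hA : A ∈ X.complex) (hAσ : A ⊆ σ.1) :
    𝒱.totalBoundary lab (𝒱.face x A) = ∑ v ∈ A, lab.incidence A v • 𝒱.face x (A.erase v) := by
  rw [face, dif_pos ⟨hA, hAσ⟩, totalBoundary_of]
  refine Finset.sum_congr rfl fun v _ => ?_
  congr 1
  unfold face
  by_cases h : A.erase v ∈ X.complex
  · rw [dif_pos ⟨h, A.erase_subset v⟩, dif_pos ⟨h, (A.erase_subset v).trans hAσ⟩, 𝒱.map_map]
  · rw [dif_neg fun h' => h h'.1, dif_neg fun h' => h h'.1]

theorem totalBoundary_totalBoundary (c : 𝒱.TotalChains) :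
    𝒱.totalBoundary lab (𝒱.totalBoundary lab c) = 0 := by
  suffices (𝒱.totalBoundary lab).comp (𝒱.totalBoundary lab) = 0 from DFunLike.congr_fun this c
  refine DirectSum.addHom_ext fun σ x => ?_
  rw [AddMonoidHom.comp_apply, totalBoundary_of, map_sum, AddMonoidHom.zero_apply]
  have : ∀ v ∈ σ.1, 𝒱.totalBoundary lab (lab.incidence σ.1 v • 𝒱.face x (σ.1.erase v)) =
      ∑ w ∈ σ.1.erase v, (lab.incidence σ.1 v * lab.incidence (σ.1.erase v) w) •
        𝒱.face x ((σ.1.erase v).erase w) := by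
    intro v hv
    rw [map_zsmul]
    by_cases h : σ.1.erase v ∈ X.complex
    · rw [totalBoundary_face x h (Finset.erase_subset _ _), Finset.smul_sum]
      exact Finset.sum_congr rfl fun w _ => smul_smul _ _ _
    · have he : σ.1.erase v = ∅ := by
        by_contra hne
        exact h ((X.complex.isRelLowerSet_faces σ.2).2 (Finset.erase_subset _ _)
          (Finset.nonempty_iff_ne_empty.2 hne))
      rw [face, dif_neg fun h' => h h'.1, map_zero, smul_zero, he, Finset.sum_empty]
  rw [Finset.sum_congr rfl this, Finset.sum_sigma']
  refine Finset.sum_involution (fun p _ => ⟨p.2, p.1⟩) ?_ ?_ ?_ ?_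
  · rintro ⟨v, w⟩ hp
    simp only [Finset.mem_sigma, Finset.mem_erase] at hp
    simp only
    rw [Finset.erase_right_comm, ← add_smul,
      lab.incidence_mul_add σ.2 hp.1 hp.2.2 hp.2.1.symm, zero_smul]
  · rintro ⟨v, w⟩ hp _ he
    simp only [Finset.mem_sigma, Finset.mem_erase] at hp
    exact hp.2.1 (by simpa using congrArg Sigma.fst he)
  · rintro ⟨v, w⟩ hp
    simp only [Finset.mem_sigma, Finset.mem_erase] at hp ⊢
    exact ⟨hp.2.2, hp.2.1.symm, hp.1⟩
  · rintro ⟨v, w⟩ hp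
    rfl

theorem totalBoundary_apply_ne_zero {c : 𝒱.TotalChains} {τ : {σ : Finset V // σ ∈ X.complex}}
    (h : 𝒱.totalBoundary lab c τ ≠ 0) :
    ∃ σ, c σ ≠ 0 ∧ ∃ v ∈ σ.1, τ.1 = σ.1.erase v := by
  by_contra! hcon
  apply h
  rw [← DirectSum.sum_support_of c, map_sum, DFinsupp.finsetSum_apply]
  refine Finset.sum_eq_zero fun σ hσ => ?_
  rw [totalBoundary_of, DFinsupp.finsetSum_apply]
  refine Finset.sum_eq_zero fun v hv => ?_
  rw [DFinsupp.smul_apply, face]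
  split_ifs with hf
  · rw [DirectSum.of_eq_of_ne, smul_zero]
    intro he
    exact hcon σ (by simpa using hσ) v hv (congrArg Subtype.val he)
  · exact smul_zero _

theorem restrict_apply {S : Set (Finset V)} (c : 𝒱.TotalChains)
    (σ : {σ : {σ : Finset V // σ ∈ X.complex} // σ.1 ∈ S}) : 𝒱.restrict S c σ = c σ.1 := by
  induction c using DirectSum.induction_on with
  | zero => rw [map_zero]; rfl
  | of τ x =>
    rw [restrict, DirectSum.toAddMonoid_of]
    by_cases hτ : τ.1 ∈ S
    · rw [dif_pos hτ]
      by_cases he : τ = σ.1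
      · subst he
        rw [DirectSum.of_eq_same]
        exact (DirectSum.of_eq_same σ.1 x).symm
      · rw [DirectSum.of_eq_of_ne _ _ _ (Ne.symm he), DirectSum.of_eq_of_ne]
        rintro rfl
        exact he rfl
    · rw [dif_neg hτ, DirectSum.of_eq_of_ne]
      · rfl
      · rintro rfl
        exact hτ σ.2
  | add x y hx hy => rw [map_add, DirectSum.add_apply, hx, hy, DirectSum.add_apply]

theorem restrict_extend {S : Set (Finset V)} (c : 𝒱.Chains S) :
    𝒱.restrict S (𝒱.extend S c) = c := by
  suffices (𝒱.restrict S).comp (𝒱.extend S) = AddMonoidHom.id _ from DFunLike.congr_fun this c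
  refine DirectSum.addHom_ext fun σ x => ?_
  rw [AddMonoidHom.comp_apply, extend, DirectSum.toAddMonoid_of, restrict,
    DirectSum.toAddMonoid_of, dif_pos σ.2]
  rfl

theorem extend_apply_ne_zero {S : Set (Finset V)} {c : 𝒱.Chains S}
    {σ : {σ : Finset V // σ ∈ X.complex}} (h : 𝒱.extend S c σ ≠ 0) : σ.1 ∈ S := by
  by_contra hσ
  apply h
  induction c using DirectSum.induction_on with
  | zero => rw [map_zero]; rfl
  | of τ x =>
    rw [extend, DirectSum.toAddMonoid_of, DirectSum.of_eq_of_ne]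
    rintro rfl
    exact hσ τ.2
  | add x y hx hy =>
    rw [map_add, DirectSum.add_apply]
    by_cases h1 : 𝒱.extend S x σ = 0 <;> by_cases h2 : 𝒱.extend S y σ = 0
    · rw [h1, h2, add_zero]
    · exact absurd (hy h2) h2
    · exact absurd (hx h1) h1
    · exact absurd (hx h1) h1

theorem extend_apply_mem {S : Set (Finset V)} (c : 𝒱.Chains S)
    {σ : {σ : Finset V // σ ∈ X.complex}} (h : σ.1 ∈ S) : 𝒱.extend S c σ = c ⟨σ, h⟩ := by
  conv_rhs => rw [← restrict_extend c]
  rw [restrict_apply]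

theorem extend_restrict {S : Set (Finset V)} {c : 𝒱.TotalChains}
    (h : ∀ σ, c σ ≠ 0 → σ.1 ∈ S) : 𝒱.extend S (𝒱.restrict S c) = c := by
  refine DFinsupp.ext fun σ => ?_
  by_cases hσ : σ.1 ∈ S
  · exact (extend_apply_mem _ hσ).trans (restrict_apply c ⟨σ, hσ⟩)
  · have h1 : c σ = 0 := by
      by_contra h'
      exact hσ (h σ h')
    have h2 : 𝒱.extend S (𝒱.restrict S c) σ = 0 := by
      by_contra h'
      exact hσ (extend_apply_ne_zero h')
    exact h2.trans h1.symm

/-- All differentials of subquotients thus come from a single differential of square zero, and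
chains on different sets of simplices can be compared in one group. -/
theorem boundary_eq {S T : Set (Finset V)} (c : 𝒱.Chains S) :
    𝒱.boundary lab S T c = 𝒱.restrict T (𝒱.totalBoundary lab (𝒱.extend S c)) := by
  suffices 𝒱.boundary lab S T =
      ((𝒱.restrict T).comp (𝒱.totalBoundary lab)).comp (𝒱.extend S) from DFunLike.congr_fun this c
  refine DirectSum.addHom_ext fun σ x => ?_
  rw [AddMonoidHom.comp_apply, AddMonoidHom.comp_apply, extend, DirectSum.toAddMonoid_of,
    totalBoundary, DirectSum.toAddMonoid_of, boundary, DirectSum.toAddMonoid_of,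
    AddMonoidHom.finsetSum_apply, AddMonoidHom.finsetSum_apply, map_sum]
  refine Finset.sum_congr rfl fun v _ => ?_
  by_cases h1 : σ.1.1.erase v ∈ X.complex
  · rw [dif_pos h1, AddMonoidHom.smul_apply, map_zsmul, AddMonoidHom.comp_apply, restrict,
      DirectSum.toAddMonoid_of]
    by_cases h2 : σ.1.1.erase v ∈ T
    · rw [dif_pos ⟨h1, h2⟩, dif_pos h2]
      rfl
    · rw [dif_neg fun h => h2 h.2, dif_neg h2]
      simp
  · rw [dif_neg h1, dif_neg fun h => h1 h.1]
    simp

end HomCoeffSystem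

/-! ### Vanishing of the homology -/

theorem eq_of_pairwise_lt {h : V → ℕ} {l l' : List V} (hl : l.Pairwise (h · < h ·))
    (hl' : l'.Pairwise (h · < h ·)) (hm : ∀ v, v ∈ l ↔ v ∈ l') : l = l' := by
  have hn : ∀ {l : List V}, l.Pairwise (h · < h ·) → l.Nodup := fun {l} hl =>
    hl.imp fun {a b} hab he => by simp [he] at hab
  refine List.Perm.eq_of_pairwise (le := (h · < h ·)) ?_ hl hl'
    ((List.perm_ext_iff_of_nodup (hn hl) (hn hl')).2 hm)
  intro a b _ _ hab hba
  omega

/-- The enumeration of `σ` by increasing height starts with `v`, and its tail, being increasing with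
vertex set that of `η`, is `η` itself. -/
theorem mem_of_erase_eq {o : Orientation X} {z : V} {h : V → ℕ} (hh : IsHeight o z h)
    {η : List V} (hη : η.Pairwise (h · < h ·)) {σ : Finset V} (hσ : σ ∈ X.complex) {v : V}
    (hv : v ∈ σ) (hση : σ.erase v = η.toFinset) (hmin : ∀ y ∈ σ, h v ≤ h y) :
    v ∈ {v | v ∈ o.nbhd η ∧ ∀ y ∈ η, h v < h y} := by
  obtain ⟨l, hl, hlm, hlh⟩ := hh.exists_sorted hσ
  obtain ⟨x, l, rfl⟩ := List.exists_cons_of_ne_nil hl.ne_nil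
  rw [List.pairwise_cons] at hlh
  have hvx : v = x := by
    rcases List.mem_cons.1 ((hlm v).1 hv) with rfl | hvl
    · rfl
    · have := hlh.1 v hvl
      have := hmin x ((hlm x).2 (by simp))
      omega
  subst hvx
  have : l = η := by
    refine eq_of_pairwise_lt hlh.2 hη fun y => ?_
    rw [← List.mem_toFinset (l := η), ← hση, Finset.mem_erase, hlm, List.mem_cons]
    constructor
    · intro hy
      refine ⟨?_, .inr hy⟩
      rintro rfl
      have := hlh.1 y hy
      omega
    · rintro ⟨h1, h2⟩
      exact h2.resolve_left h1
  subst this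
  exact ⟨hl, hlh.1⟩

/-! ### Clearing the highest faces of a cycle -/

namespace HomCoeffSystem

variable {𝒱 : HomCoeffSystem.{u, w} X} {lab : Labelling X} {o : Orientation X} {z : V} {h : V → ℕ}
  {k : ℕ}

/-- A cycle whose simplices have no faces beyond `η` can be changed by a boundary such that `η` is
no longer a face of its simplices. -/
theorem exists_clear (hh : IsHeight o z h) (hS : 𝒱.SStar lab o k) (hk : 1 ≤ k) {n : ℕ}
    {η₀ : Finset V} (hη₀ : ∑ v ∈ η₀, h v = n) {T : Finset (Finset V)}
    (hT : ∀ η ∈ T, ∑ v ∈ η, h v = n) {c : 𝒱.TotalChains} (hc : 𝒱.totalBoundary lab c = 0)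
    (hcard : ∀ σ, c σ ≠ 0 → σ.1.card = k + 1)
    (hbound : ∀ σ, c σ ≠ 0 → ∀ v ∈ σ.1,
      ∑ y ∈ σ.1.erase v, h y < n ∨ σ.1.erase v ∈ insert η₀ T) :
    ∃ b : 𝒱.TotalChains, (∀ σ, b σ ≠ 0 → σ.1.card = k + 2) ∧
      ∀ σ, (c - 𝒱.totalBoundary lab b) σ ≠ 0 → ∀ v ∈ σ.1,
        ∑ y ∈ σ.1.erase v, h y < n ∨ σ.1.erase v ∈ T := by
  by_cases hex : ∃ σ, c σ ≠ 0 ∧ ∃ v ∈ σ.1, σ.1.erase v = η₀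
  swap
  · push Not at hex
    refine ⟨0, fun σ hσ => absurd rfl hσ, fun σ hσ v hv => ?_⟩
    rw [map_zero, sub_zero] at hσ
    refine (hbound σ hσ v hv).imp_right fun h => ?_
    exact (Finset.mem_insert.1 h).resolve_left (hex σ hσ v hv)
  obtain ⟨σ₀, hσ₀, v₀, hv₀, he₀⟩ := hex
  have hη₀card : η₀.card = k := by
    rw [← he₀, Finset.card_erase_of_mem hv₀, hcard σ₀ hσ₀, Nat.add_sub_cancel]
  have hη₀X : η₀ ∈ X.complex := by
    refine (X.complex.isRelLowerSet_faces σ₀.2).2 (he₀ ▸ Finset.erase_subset _ _) ?_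
    exact Finset.card_pos.1 (by omega)
  obtain ⟨η, hη, hηm, hηh⟩ := hh.exists_sorted hη₀X
  obtain rfl : η₀ = η.toFinset := by
    ext v
    rw [hηm, List.mem_toFinset]
  have hlen : η.length = k := by rw [← hη₀card, List.toFinset_card_of_nodup hη.nodup]
  set M : Set V := {v | v ∈ o.nbhd η ∧ ∀ y ∈ η, h v < h y} with hM
  have hexact := hS η hη hlen M (hh.stable hηh hη.ne_nil)
  have hMη : ∀ v ∈ M, v ∉ η.toFinset := fun v hv hvη => by
    have := hv.2 v (List.mem_toFinset.1 hvη)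
    omega
  -- No face of `σ` has sum above `n`, the sum of the face opposite to `v`; hence `v` is a lowest
  -- vertex of `σ`.
  have hmemM : ∀ σ, c σ ≠ 0 → ∀ v ∈ σ.1, σ.1.erase v = η.toFinset → v ∈ M := by
    intro σ hσ v hv he
    refine mem_of_erase_eq hh hηh σ.2 hv he fun y hy => ?_
    have h1 := Finset.sum_erase_add σ.1 h hv
    have h2 := Finset.sum_erase_add σ.1 h hy
    rw [he, hη₀] at h1
    have h3 : ∑ x ∈ σ.1.erase y, h x ≤ n := by
      rcases hbound σ hσ y hy with h | h
      · exact h.le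
      · rcases Finset.mem_insert.1 h with h | h
        · rw [h, hη₀]
        · exact (hT _ h).le
    omega
  have hmemCone : ∀ σ, c σ ≠ 0 → ∀ v ∈ σ.1, σ.1.erase v = η.toFinset → σ.1 ∈ coneSet η M := by
    intro σ hσ v hv he
    refine ⟨v, hmemM σ hσ v hv he, ?_⟩
    rw [← he, ← Finset.insert_eq, Finset.insert_erase hv]
  -- All simplices of `c` with face `η` belong to the cone, so at `η` the boundary of the
  -- restriction agrees with that of `c`.
  have hzero : 𝒱.boundary lab (coneSet η M) {η.toFinset} (𝒱.restrict (coneSet η M) c) = 0 := by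
    rw [boundary_eq]
    refine DFinsupp.ext fun τ => ?_
    refine (restrict_apply _ τ).trans ?_
    by_contra hne
    have hne' : 𝒱.totalBoundary lab
        (𝒱.extend (coneSet η M) (𝒱.restrict (coneSet η M) c) - c) τ.1 ≠ 0 := by
      rw [map_sub, hc, sub_zero]
      exact hne
    obtain ⟨σ, hσ, v, hv, hτ⟩ := totalBoundary_apply_ne_zero hne'
    have hτ' : σ.1.erase v = η.toFinset := hτ.symm.trans τ.2
    rw [DirectSum.sub_apply] at hσ
    by_cases hσc : σ.1 ∈ coneSet η M
    · rw [extend_apply_mem _ hσc, restrict_apply, sub_self] at hσ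
      exact hσ rfl
    · have h1 : 𝒱.extend (coneSet η M) (𝒱.restrict (coneSet η M) c) σ = 0 := by
        by_contra h'
        exact hσc (extend_apply_ne_zero h')
      rw [h1, zero_sub, neg_ne_zero] at hσ
      exact hσc (hmemCone σ hσ v hv hτ')
  obtain ⟨b, hb⟩ := (hexact _).1 hzero
  rw [boundary_eq] at hb
  refine ⟨𝒱.extend _ b, fun σ hσ => ?_, fun σ hσ v hv => ?_⟩
  · obtain ⟨x, hx, y, hy, hxy, -, he⟩ := extend_apply_ne_zero hσ
    rw [he, Finset.card_union_of_disjoint, Finset.card_pair hxy, hη₀card, add_comm]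
    rw [Finset.disjoint_insert_left, Finset.disjoint_singleton_left]
    exact ⟨hMη x hx, hMη y hy⟩
  · rw [DirectSum.sub_apply] at hσ
    -- By the choice of `b` the new chain vanishes on the cone.
    have hσc : σ.1 ∉ coneSet η M := by
      intro hσc
      apply hσ
      have := congrArg (fun e => e ⟨σ, hσc⟩) hb
      simp only [restrict_apply] at this
      rw [this, sub_self]
    by_cases hD : 𝒱.totalBoundary lab (𝒱.extend _ b) σ = 0
    · rw [hD, sub_zero] at hσ
      refine (hbound σ hσ v hv).imp_right fun h => (Finset.mem_insert.1 h).resolve_left fun he => ?_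
      exact hσc (hmemCone σ hσ v hv he)
    · left
      -- Here `σ` is ρ \ {u} with ρ = {x, y} ∪ η, and `u` lies in η since `σ` is outside the cone.
      -- Its face opposite to `v` has sum h x + h y + n - h u - h v, which is less than `n` whether
      -- `v` is `x`, `y` or in η.
      obtain ⟨ρ, hρ, u, hu, he⟩ := totalBoundary_apply_ne_zero hD
      obtain ⟨x, hx, y, hy, hxy, -, hρe⟩ := extend_apply_ne_zero hρ
      have hxη := hMη x hx
      have hyη := hMη y hy
      have hux : u ≠ x := by
        rintro rfl
        refine hσc ⟨y, hy, ?_⟩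
        rw [he, hρe]
        ext t
        simp only [Finset.mem_erase, Finset.mem_union, Finset.mem_insert, Finset.mem_singleton]
        constructor
        · tauto
        · rintro (rfl | ht)
          · exact ⟨hxy.symm, by simp⟩
          · exact ⟨fun h => hxη (h ▸ ht), .inr ht⟩
      have huy : u ≠ y := by
        rintro rfl
        refine hσc ⟨x, hx, ?_⟩
        rw [he, hρe]
        ext t
        simp only [Finset.mem_erase, Finset.mem_union, Finset.mem_insert, Finset.mem_singleton]
        constructor
        · tauto
        · rintro (rfl | ht)
          · exact ⟨hxy, by simp⟩
          · exact ⟨fun h => hyη (h ▸ ht), .inr ht⟩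
      have huη : u ∈ η := by
        rw [hρe] at hu
        simpa [hux, huy] using hu
      have hsum : ∑ t ∈ ρ.1, h t = h x + h y + n := by
        rw [hρe, Finset.sum_union, Finset.sum_pair hxy, hη₀]
        rw [Finset.disjoint_insert_left, Finset.disjoint_singleton_left]
        exact ⟨hxη, hyη⟩
      have h1 := Finset.sum_erase_add ρ.1 h hu
      rw [← he] at h1
      have h2 := Finset.sum_erase_add σ.1 h hv
      have hxu := hx.2 u huη
      have hyu := hy.2 u huη
      rw [he, hρe] at hv
      simp only [Finset.mem_erase, Finset.mem_union, Finset.mem_insert, Finset.mem_singleton,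
        List.mem_toFinset] at hv
      rcases hv.2 with (hvx | hvy) | hvη
      · rw [hvx] at h2 ⊢
        omega
      · rw [hvy] at h2 ⊢
        omega
      · have := hx.2 v hvη
        have := hy.2 v hvη
        omega

/-- The set `T` lists the faces of sum exactly `n` still to be cleared; `exists_clear` removes them
singly. When `T` is empty the bound `n + 1` improves to `n`, with the finitely many faces of sum `n`
as the new `T`. For `n = 0` and `T` empty no simplex can carry the cycle, because it would have a
face. -/
theorem exists_totalBoundary_eq (hh : IsHeight o z h) (hS : 𝒱.SStar lab o k) (hk : 1 ≤ k) (n : ℕ)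
    (T : Finset (Finset V)) (hT : ∀ η ∈ T, ∑ v ∈ η, h v = n) (c : 𝒱.TotalChains)
    (hc : 𝒱.totalBoundary lab c = 0) (hcard : ∀ σ, c σ ≠ 0 → σ.1.card = k + 1)
    (hbound : ∀ σ, c σ ≠ 0 → ∀ v ∈ σ.1, ∑ y ∈ σ.1.erase v, h y < n ∨ σ.1.erase v ∈ T) :
    ∃ b : 𝒱.TotalChains, (∀ σ, b σ ≠ 0 → σ.1.card = k + 2) ∧ 𝒱.totalBoundary lab b = c := by
  induction n generalizing T c with
  | zero | succ n ihn => ?_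
  all_goals
    induction T using Finset.induction_on generalizing c with
    | empty => ?_
    | insert η₀ T _ ih =>
      obtain ⟨b, hb, hb'⟩ := exists_clear hh hS hk (hT η₀ (by simp))
        (fun η hη => hT η (by simp [hη])) hc hcard hbound
      obtain ⟨b', hb1, hb2⟩ := ih (fun η hη => hT η (by simp [hη])) (c - 𝒱.totalBoundary lab b)
        (by rw [map_sub, hc, totalBoundary_totalBoundary, sub_zero]) (fun σ hσ => by
          by_cases hσc : c σ = 0
          · rw [DirectSum.sub_apply, hσc, zero_sub, neg_ne_zero] at hσ
            obtain ⟨ρ, hρ, v, hv, he⟩ := totalBoundary_apply_ne_zero hσ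
            rw [he, Finset.card_erase_of_mem hv, hb ρ hρ]
            rfl
          · exact hcard σ hσc) hb'
      refine ⟨b + b', fun σ hσ => ?_, by rw [map_add, hb2, add_sub_cancel]⟩
      by_cases hσb : b σ = 0
      · rw [DirectSum.add_apply, hσb, zero_add] at hσ
        exact hb1 σ hσ
      · exact hb σ hσb
  · refine ⟨0, fun σ hσ => absurd rfl hσ, ?_⟩
    rw [map_zero]
    refine (DFinsupp.ext fun σ => ?_).symm
    by_contra hσ
    obtain ⟨v, hv⟩ := Finset.card_pos.1 (by rw [hcard σ hσ]; omega)
    simpa using hbound σ hσ v hv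
  · refine ihn ((c.support.biUnion fun σ => σ.1.image fun v => σ.1.erase v).filter
      fun η => ∑ v ∈ η, h v = n) (fun η hη => (Finset.mem_filter.1 hη).2) c hc hcard
      fun σ hσ v hv => ?_
    rcases hbound σ hσ v hv with hlt | hm
    · rcases (Nat.lt_succ_iff.1 hlt).eq_or_lt with he | hlt
      · right
        refine Finset.mem_filter.2 ⟨Finset.mem_biUnion.2 ⟨σ, by simpa using hσ, ?_⟩, he⟩
        exact Finset.mem_image_of_mem _ hv
      · exact .inl hlt
    · simp at hm

theorem subsingleton_homology (o : Orientation X) (hS : 𝒱.SStar lab o k) (hk : 1 ≤ k) :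
    Subsingleton (𝒱.Homology lab k) := by
  obtain ⟨z, h, hh⟩ := exists_isHeight o
  obtain ⟨k, rfl⟩ : ∃ j, k = j + 1 := ⟨k - 1, by omega⟩
  rw [Homology, QuotientAddGroup.subsingleton_iff, AddSubgroup.addSubgroupOf_eq_top]
  intro c hc
  have hc' : 𝒱.boundary lab (dimSet V (k + 1)) (dimSet V k) c = 0 := hc
  set C := 𝒱.extend _ c with hC
  have hcard : ∀ σ, C σ ≠ 0 → σ.1.card = k + 1 + 1 := fun σ hσ => extend_apply_ne_zero hσ
  have hD : 𝒱.totalBoundary lab C = 0 := by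
    rw [boundary_eq] at hc'
    rw [← extend_restrict (S := dimSet V k) (c := 𝒱.totalBoundary lab C), hc', map_zero]
    intro τ hτ
    obtain ⟨σ, hσ, v, hv, he⟩ := totalBoundary_apply_ne_zero hτ
    change τ.1.card = k + 1
    rw [he, Finset.card_erase_of_mem hv, hcard σ hσ]
    rfl
  -- The total height of all simplices in the support, plus one, exceeds the sum of every face, so
  -- the descent can start with `T` empty.
  obtain ⟨b, hb, hbC⟩ := exists_totalBoundary_eq hh hS hk
    (∑ σ ∈ C.support, ∑ v ∈ σ.1, h v + 1) ∅ (by simp) C hD hcard (fun σ hσ v hv => by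
      left
      have h1 := Finset.single_le_sum (f := fun σ => ∑ v ∈ σ.1, h v) (fun _ _ => Nat.zero_le _)
        (show σ ∈ C.support by simpa using hσ)
      have h2 := Finset.sum_erase_add σ.1 h hv
      omega)
  refine ⟨𝒱.restrict _ b, ?_⟩
  rw [boundary_eq, extend_restrict fun σ hσ => hb σ hσ, hbC, hC, restrict_extend]

end HomCoeffSystem

end Homology

end TildeA

theorem mainTheorem5 {d : ℕ} {V : Type*} (X : TildeA.Building d V)
    (o : TildeA.Orientation X) (lab : TildeA.Labelling X)
    (𝒱 : TildeA.HomCoeffSystem X) (k : ℕ) (hk₁ : 1 ≤ k) (hkd : k ≤ d)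
    (hS : 𝒱.SStar lab o k) :
    Subsingleton (𝒱.Homology lab k) :=
  TildeA.HomCoeffSystem.subsingleton_homology o hS hk₁
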